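/- **Setting.** Let $\mathcal S,\mathcal A$ be finite sets with $|\mathcal S|=S$, $|\mathcal A|=A$, let $H,T\ge 1$ be integers, $\rho,\delta\in(0,1)$, $\eta>0$. An episodic MDP is given by an initial distribution $p$ on $\mathcal S$ and a transition kernel $P(s'\mid s,a,h)$, $h\in[H]$, with $P(s'\mid s,a,H)=p(s')$. For a policy $\pi(a\mid s,h)$, an episode generates $s_1\sim p$, $a_h\sim\pi(\cdot\mid s_h,h)$, $s_{h+1}\sim P(\cdot\mid s_h,a_h,h)$ for $h=1,\dots,H$; its occupancy measure is $q^{P,\pi}(s,a,h)=\mathbb P[s_h=s,\,a_h=a]$. Write $\langle f,q\rangle=\sum_{s,a,h}f(s,a,h)q(s,a,h)$. In episode $t\in[T]$ reward and consumption functions $f_t,g_t:\mathcal S\times\mathcal A\times[H]\to[0,1]$ are revealed; they may be random and depend on the past (in particular they may be i.i.d. or deterministic). There is an action $a^\star$ with $f_t(s,a^\star,h)=g_t(s,a^\star,h)=0$ for all $s,h,t$. Given all the information available at the beginning of episode $t$ (including $f_t,g_t$ and the previous trajectories), a policy $\pi_t$ and a measure $\widehat q_t$ are chosen and a trajectory is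 generated by $p,P,\pi_t$. Let $N_t(s,a,h)$ (resp. $M_t(s,a,s',h)$) be the number of episodes before $t$ with $(s_h,a_h)=(s,a)$ (resp. $(s_h,a_h,s_{h+1})=(s,a,s')$), $\bar P_t(s'\mid s,a,h)=M_t(s,a,s',h)/\max\{1,N_t(s,a,h)\}$, $$\epsilon_t(s'\mid s,a,h)=2\sqrt{\frac{\bar P_t(s'\mid s,a,h)\ln(HSAT/\delta)}{\max\{1,N_t(s,a,h)-1\}}}+\frac{14\ln(HSAT/\delta)}{3\max\{1,N_t(s,a,h)-1\}},$$ and let $\mathcal P_t$ be the set of transition kernels $\widehat P$ with $|\widehat P-\bar P_t|\le\epsilon_t$ at every $(s,a,s',h)$. Let $\Delta(P,t)$ be the set of $q:\mathcal S\times\mathcal A\times[H]\to[0,1]$ for which there is $\bar q:\mathcal S\times\mathcal A\times\mathcal S\times[H]\to[0,1]$ with $q(s,a,h)=\sum_{s'}\bar q(s,a,s',h)$, $\sum_{s,a,s'}\bar q(s,a,s',h)=1$ for all $h$, $\sum_{s',a}\bar q(s,a,s',h)=\sum_{s',a}\bar q(s',a,s,h-1)$ for all $s$ and $2\le h\le H$,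 $\sum_{s',a}\bar q(s,a,s',1)=p(s)$ for all $s$, and such that some kernel in $\mathcal P_t$ equals $\bar q(s,a,s',h)/\sum_{s''}\bar q(s,a,s'',h)$ wherever the denominator is nonzero. **Algorithm.** The initial budget is $TH\rho$; playing $a$ in state $s$ at step $h$ of episode $t$ consumes $g_t(s,a,h)$, and the run ends after the first step at which the remaining budget is below $1$; $T^\star$ denotes the episode in which this happens ($T^\star=T$ if it never happens). For $t\le T^\star$, $$\widehat q_t\in\arg\max_{q\in\Delta(P,t)}\{\langle f_t,q\rangle-\lambda_t\langle g_t,q\rangle\},$$ $\pi_t$ is a policy with $\pi_t(a\mid s,h)=\widehat q_t(s,a,h)/\sum_b\widehat q_t(s,b,h)$ wherever the denominator is nonzero, and the dual variables $\lambda_t\ge0$ satisfy $\lambda_{t+1}\in\arg\min_{\lambda\ge0}\{\eta(H\rho-\langle g_t,\widehat q_t\rangle)\lambda+D(\lambda,\lambda_t)\}$ for $t<T^\star$, with $D(x,y)=\psi(x)-\psi(y)-\psi'(y)(x-y)$ for a reference function $\psi$. For $t>T^\star$, $\pi_t$ always plays $a^\star$ and $\widehat q_t=q^{P,\pi_t}$.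 Let $q_t=q^{P,\pi_t}$ for $t\in[T]$. **Lemma.** There is an absolute constant $C>0$ such that in every such setting, with probability at least $1-4\delta$, $$\left|\sum_{t=1}^T\langle f_t,\widehat q_t-q_t\rangle\right|\le C\left(H^{3/2}S\sqrt{AT}+H^{5/2}S^2A\right)\left(\ln\frac{HSAT}{\delta}\right)^2.$$ -/

import Mathlib

open MeasureTheory ProbabilityTheory

noncomputable section

namespace EpisodicMDP

/-! Steps are indexed by `Fin H` (the index `h` stands for step `h + 1`) and
episodes by natural numbers `t < T` (the first episode is `t = 0`). -/

/-- Real functions of `(s, a, h)`, for instance reward functions and occupancy measures. -/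
abbrev Fn (S A : Type*) (H : ℕ) := S → A → Fin H → ℝ

/-- Real functions of `(s, a, s', h)`; a kernel `P` is written `P s a s' h` for `P(s' ∣ s, a, h)`. -/
abbrev Fn' (S A : Type*) (H : ℕ) := S → A → S → Fin H → ℝ

/-- Real functions of `(s, h, a)`; a policy `π` is written `π s h a` for `π(a ∣ s, h)`. -/
abbrev PolicyFn (S A : Type*) (H : ℕ) := S → Fin H → A → ℝ

/-- A trajectory of one episode: states `s_1, …, s_{H+1}` and actions `a_1, …, a_H`. -/
abbrev Traj (S A : Type*) (H : ℕ) := (Fin (H + 1) → S) × (Fin H → A)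

variable {S A : Type*} [Fintype S] [Fintype A] {H : ℕ}

/-- `P` is a (nonstationary) transition kernel: each `P(· ∣ s, a, h)` is a probability vector. -/
def IsKernel (P : Fn' S A H) : Prop :=
  (∀ s a s' h, 0 ≤ P s a s' h) ∧ ∀ s a h, ∑ s', P s a s' h = 1

/-- `π` is a (nonstationary, stochastic) policy. -/
def IsPolicy (π : PolicyFn S A H) : Prop :=
  (∀ s h a, 0 ≤ π s h a) ∧ ∀ s h, ∑ a, π s h a = 1

/-- `p` is an initial distribution and `P` a transition kernel whose last step has law `p`
(the convention `P(s' ∣ s, a, H) = p(s')`). -/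
structure IsMDP (p : S → ℝ) (P : Fn' S A H) : Prop where
  init_nonneg : ∀ s, 0 ≤ p s
  init_sum : ∑ s, p s = 1
  kernel : IsKernel P
  last : ∀ s a s' (h : Fin H), (h : ℕ) + 1 = H → P s a s' h = p s'

/-- The probability of a trajectory when the episode starts from `p`, actions are drawn from `π`
and states move according to `P`. -/
def trajProb (p : S → ℝ) (P : Fn' S A H) (π : PolicyFn S A H) (x : Traj S A H) : ℝ :=
  p (x.1 0) *
    ∏ h : Fin H, π (x.1 h.castSucc) h (x.2 h) * P (x.1 h.castSucc) (x.2 h) (x.1 h.succ) h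

open Classical in
/-- `q̄^{P,π}(s, a, s', h)`, the probability of `s_h = s`, `a_h = a`, `s_{h+1} = s'`. -/
def occBar (p : S → ℝ) (P : Fn' S A H) (π : PolicyFn S A H) : Fn' S A H := fun s a s' h =>
  ∑ x : Traj S A H,
    if x.1 h.castSucc = s ∧ x.2 h = a ∧ x.1 h.succ = s' then trajProb p P π x else 0

/-- The occupancy measure `q^{P,π}(s, a, h) = ∑_{s'} q̄^{P,π}(s, a, s', h)`. -/
def occ (p : S → ℝ) (P : Fn' S A H) (π : PolicyFn S A H) : Fn S A H := fun s a h =>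
  ∑ s', occBar p P π s a s' h

/-- The inner product `⟨f, q⟩` of functions on `S × A × [H]`. -/
def pairing (f q : Fn S A H) : ℝ := ∑ s, ∑ a, ∑ h, f s a h * q s a h

/-! ### Confidence sets -/

open Classical in
/-- `N_t(s, a, h)`: the number of episodes before `t` that visit `(s, a)` at step `h`. -/
def visits (X : ℕ → Traj S A H) (t : ℕ) (s : S) (a : A) (h : Fin H) : ℕ :=
  ((Finset.range t).filter fun i => (X i).1 h.castSucc = s ∧ (X i).2 h = a).card

open Classical in
/-- `M_t(s, a, s', h)`: the number of episodes before `t` that visit `(s, a)` at step `h` and then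
move to `s'`. -/
def visits' (X : ℕ → Traj S A H) (t : ℕ) (s : S) (a : A) (s' : S) (h : Fin H) : ℕ :=
  ((Finset.range t).filter fun i =>
    (X i).1 h.castSucc = s ∧ (X i).2 h = a ∧ (X i).1 h.succ = s').card

/-- The empirical transition kernel `P̄_t`. -/
def empirical (X : ℕ → Traj S A H) (t : ℕ) : Fn' S A H := fun s a s' h =>
  (visits' X t s a s' h : ℝ) / max 1 (visits X t s a h : ℝ)

variable (S A H) in
/-- The logarithmic factor `ln (HSAT / δ)`. -/
def logFactor (T : ℕ) (δ : ℝ) : ℝ :=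
  Real.log ((H : ℝ) * Fintype.card S * Fintype.card A * T / δ)

/-- The confidence radius `ε_t(s' ∣ s, a, h)`. -/
def radius (T : ℕ) (δ : ℝ) (X : ℕ → Traj S A H) (t : ℕ) : Fn' S A H := fun s a s' h =>
  2 * √(empirical X t s a s' h * logFactor S A H T δ / max 1 ((visits X t s a h : ℝ) - 1))
    + 14 * logFactor S A H T δ / (3 * max 1 ((visits X t s a h : ℝ) - 1))

/-- The confidence set `𝒫_t` of transition kernels. -/
def confSet (T : ℕ) (δ : ℝ) (X : ℕ → Traj S A H) (t : ℕ) : Set (Fn' S A H) :=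
  {Phat | IsKernel Phat ∧
    ∀ s a s' h, |Phat s a s' h - empirical X t s a s' h| ≤ radius T δ X t s a s' h}

/-- `P` is (a version of) the kernel induced by `q̄`: it equals
`q̄(s, a, s', h) / ∑_{s''} q̄(s, a, s'', h)` wherever the denominator does not vanish. -/
def InducesKernel (qbar P : Fn' S A H) : Prop :=
  ∀ s a h, ∑ s'', qbar s a s'' h ≠ 0 →
    ∀ s', P s a s' h = qbar s a s' h / ∑ s'', qbar s a s'' h

/-- `π` is (a version of) the policy induced by `q`: it equals
`q(s, a, h) / ∑_b q(s, b, h)` wherever the denominator does not vanish. -/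
def InducesPolicy (q : Fn S A H) (π : PolicyFn S A H) : Prop :=
  ∀ s h, ∑ b, q s b h ≠ 0 → ∀ a, π s h a = q s a h / ∑ b, q s b h

/-- `q̄` is a flow on the layered graph: values in `[0,1]`, total mass one in each layer,
conservation between consecutive layers, and initial distribution `p`. -/
structure IsFlow (p : S → ℝ) (qbar : Fn' S A H) : Prop where
  mem_Icc : ∀ s a s' h, qbar s a s' h ∈ Set.Icc (0 : ℝ) 1
  mass : ∀ h, ∑ s, ∑ a, ∑ s', qbar s a s' h = 1
  conservation : ∀ (s : S) (h h' : Fin H), (h' : ℕ) + 1 = h →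
    ∑ s', ∑ a, qbar s a s' h = ∑ s', ∑ a, qbar s' a s h'
  initial : ∀ (s : S) (h : Fin H), (h : ℕ) = 0 → ∑ s', ∑ a, qbar s a s' h = p s

/-- The relaxed feasible set `Δ(P, t)`: occupancy measures whose induced kernel is in `𝒫_t`. -/
def feasible (p : S → ℝ) (T : ℕ) (δ : ℝ) (X : ℕ → Traj S A H) (t : ℕ) : Set (Fn S A H) :=
  {q | (∀ s a h, q s a h ∈ Set.Icc (0 : ℝ) 1) ∧
    ∃ qbar : Fn' S A H, IsFlow p qbar ∧ (∀ s a h, q s a h = ∑ s', qbar s a s' h) ∧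
      ∃ Phat ∈ confSet T δ X t, InducesKernel qbar Phat}

/-! ### The algorithm -/

/-- The budget left right after step `h` of episode `t`, starting from the budget `T H ρ`. -/
def budgetAfter (T : ℕ) (ρ : ℝ) (g : ℕ → Fn S A H) (X : ℕ → Traj S A H)
    (t : ℕ) (h : Fin H) : ℝ :=
  (T : ℝ) * H * ρ
    - ∑ i ∈ Finset.range t, ∑ k : Fin H, g i ((X i).1 k.castSucc) ((X i).2 k) k
    - ∑ k ∈ Finset.Iic h, g t ((X t).1 k.castSucc) ((X t).2 k) k

/-- Episode `t` is started (`t ≤ T⋆`): the budget has not dropped below `1` in an earlier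
episode. -/
def Active (T : ℕ) (ρ : ℝ) (g : ℕ → Fn S A H) (X : ℕ → Traj S A H) (t : ℕ) : Prop :=
  ∀ i < t, ∀ h : Fin H, 1 ≤ budgetAfter T ρ g X i h

/-- The Bregman divergence of the reference function `ψ`. -/
def bregman (ψ : ℝ → ℝ) (x y : ℝ) : ℝ := ψ x - ψ y - deriv ψ y * (x - y)

open Classical in
/-- A random run, over `T` episodes, of online dual mirror descent with optimistic occupancy
measures. `ℱ t` is the information available when the policy of episode `t` is chosen.

`X t` is the trajectory that the policy `π t` generates; the run ends (`T⋆ = t`) at the first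
step of it after which the budget is below `1`, and nothing the algorithm does or learns depends on
the rest of `X t`. -/
structure IsRun {Ω : Type*} [mΩ : MeasurableSpace Ω] (μ : Measure Ω)
    (p : S → ℝ) (P : Fn' S A H) (astar : A) (T : ℕ) (ρ δ η : ℝ) (ψ : ℝ → ℝ)
    (ℱ : Filtration ℕ mΩ) (f g : ℕ → Ω → Fn S A H) (X : ℕ → Ω → Traj S A H)
    (lam : ℕ → Ω → ℝ) (qhat : ℕ → Ω → Fn S A H) (π : ℕ → Ω → PolicyFn S A H) : Prop where
  /-- Rewards and consumptions take values in `[0,1]`. -/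
  f_mem : ∀ t < T, ∀ ω s a h, f t ω s a h ∈ Set.Icc (0 : ℝ) 1
  g_mem : ∀ t < T, ∀ ω s a h, g t ω s a h ∈ Set.Icc (0 : ℝ) 1
  /-- The default action yields no reward and consumes nothing. -/
  default_action : ∀ t < T, ∀ ω s h, f t ω s astar h = 0 ∧ g t ω s astar h = 0
  /-- Rewards and consumptions are revealed at the beginning of the episode, and the decisions
  are made on the basis of the information available then. -/
  f_meas : ∀ t < T, ∀ s a h, Measurable[ℱ t] fun ω => f t ω s a h
  g_meas : ∀ t < T, ∀ s a h, Measurable[ℱ t] fun ω => g t ω s a h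
  qhat_meas : ∀ t < T, ∀ s a h, Measurable[ℱ t] fun ω => qhat t ω s a h
  π_meas : ∀ t < T, ∀ s h a, Measurable[ℱ t] fun ω => π t ω s h a
  X_meas : ∀ t < T, ∀ x, MeasurableSet[ℱ (t + 1)] {ω | X t ω = x}
  /-- Given the past, the trajectory of episode `t` is generated by `p`, `P` and `π t`. -/
  X_law : ∀ t < T, ∀ x : Traj S A H,
    μ[Set.indicator {ω | X t ω = x} (fun _ => (1 : ℝ)) | ℱ t]
      =ᵐ[μ] fun ω => trajProb p P (π t ω) x
  /-- Policy update: `q̂_t` maximises `⟨f_t, q⟩ - λ_t ⟨g_t, q⟩` over `Δ(P, t)`. -/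
  qhat_mem : ∀ t < T, ∀ ω, Active T ρ (fun i => g i ω) (fun i => X i ω) t →
    qhat t ω ∈ feasible p T δ (fun i => X i ω) t
  qhat_max : ∀ t < T, ∀ ω, Active T ρ (fun i => g i ω) (fun i => X i ω) t →
    IsMaxOn (fun q => pairing (f t ω) q - lam t ω * pairing (g t ω) q)
      (feasible p T δ (fun i => X i ω) t) (qhat t ω)
  /-- `π_t` is the policy induced by `q̂_t`. -/
  π_policy : ∀ t < T, ∀ ω, IsPolicy (π t ω)
  π_induced : ∀ t < T, ∀ ω, Active T ρ (fun i => g i ω) (fun i => X i ω) t →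
    InducesPolicy (qhat t ω) (π t ω)
  /-- Dual update by mirror descent over `ℝ₊`. -/
  lam_nonneg : ∀ t < T, ∀ ω, Active T ρ (fun i => g i ω) (fun i => X i ω) t → 0 ≤ lam t ω
  lam_update : ∀ t, t + 1 < T → ∀ ω, Active T ρ (fun i => g i ω) (fun i => X i ω) (t + 1) →
    IsMinOn (fun l => η * (H * ρ - pairing (g t ω) (qhat t ω)) * l + bregman ψ l (lam t ω))
      (Set.Ici 0) (lam (t + 1) ω)
  /-- After the end of the run, `π_t` plays the default action and both `q_t` and `q̂_t` are the
  occupancy measure of this policy. -/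
  π_stopped : ∀ t < T, ∀ ω, ¬ Active T ρ (fun i => g i ω) (fun i => X i ω) t →
    ∀ s h a, π t ω s h a = if a = astar then 1 else 0
  qhat_stopped : ∀ t < T, ∀ ω, ¬ Active T ρ (fun i => g i ω) (fun i => X i ω) t →
    qhat t ω = occ p P (π t ω)

end EpisodicMDP

end

/-! On a good event, `qhat t` is the occupancy measure of `π t` under some kernel P̂ that is
entrywise Bernstein-close to P (`eq_occ_of_isFlow`, `abs_sub_le_of_mem_confSet`); after the run has
stopped, P̂ = P. By the performance difference identity `pairing_occ_sub`, ⟨f, q̂ - q⟩ is then the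
sum over the true occupancy q of the one-step errors (P̂ - P)V, where V is the value function of P̂.

Both kernels have mass one, so V may be centred at its mean under P. Cauchy-Schwarz over s' bounds
each error by √(S L / N) times the standard deviation of V, plus S L H / N, up to constants
(`abs_bellmanGap_le`), with L the logarithmic factor and N the visit count. Let Y be the sum of the
absolute errors over all episodes. A second Cauchy-Schwarz bounds Y through the sum K of q / N and
the total variance Z.

K is of order HSA·L: realised visits give a harmonic sum, and an exponential supermartingale
compares expected visits with realised ones. Z is at most 2H(HT + Y) by a law of total variance
(`pairing_valueVar_le`), where Y reappears because V belongs to P̂ while the states move under P.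
The resulting inequality for Y is self-bounding and is solved by `le_of_le_sqrt_self`. The variance
bound is what gives H^{3/2}: it replaces the crude H²·HT by order H·HT.

The good event consists of `CountsConcentrate` and `OccBounded`. Both follow from Chernoff bounds
for products with conditional mean at most one (`IsRun.integral_prod_le_one`) and union bounds. -/

set_option linter.unusedSectionVars false

noncomputable section

namespace EpisodicMDP

variable {S A : Type*} [Fintype S] [Fintype A] {H : ℕ}

/-! ### State marginals and sums over trajectories -/

/-- The law of the state `s_{k+1}` under `p`, `P`, `π`. -/
def stateMarg (p : S → ℝ) (P : Fn' S A H) (π : PolicyFn S A H) (k : Fin (H + 1)) : S → ℝ :=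
  Fin.induction (motive := fun _ => S → ℝ) p
    (fun h d s' => ∑ s, ∑ a, d s * π s h a * P s a s' h) k

theorem stateMarg_zero (p : S → ℝ) (P : Fn' S A H) (π : PolicyFn S A H) :
    stateMarg p P π 0 = p := rfl

theorem stateMarg_succ (p : S → ℝ) (P : Fn' S A H) (π : PolicyFn S A H) (h : Fin H) (s' : S) :
    stateMarg p P π h.succ s' = ∑ s, ∑ a, stateMarg p P π h.castSucc s * π s h a * P s a s' h := by
  simp [stateMarg]

/-- Restriction of a kernel to all steps but the last. -/
def Fn'.init (P : Fn' S A (H + 1)) : Fn' S A H := fun s a s' h => P s a s' h.castSucc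

/-- Restriction of a policy to all steps but the last. -/
def PolicyFn.init (π : PolicyFn S A (H + 1)) : PolicyFn S A H := fun s h a => π s h.castSucc a

theorem stateMarg_castSucc (p : S → ℝ) (P : Fn' S A (H + 1)) (π : PolicyFn S A (H + 1))
    (k : Fin (H + 1)) : stateMarg p P π k.castSucc = stateMarg p P.init π.init k := by
  induction k using Fin.induction with
  | zero => rfl
  | succ h ih =>
    ext s'
    rw [Fin.castSucc_succ, stateMarg_succ, ih, stateMarg_succ]
    rfl

theorem trajProb_snoc (p : S → ℝ) (P : Fn' S A (H + 1)) (π : PolicyFn S A (H + 1))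
    (x : Fin (H + 1) → S) (y : Fin H → A) (s' : S) (a : A) :
    trajProb p P π (Fin.snoc (α := fun _ => S) x s', Fin.snoc (α := fun _ => A) y a) =
      trajProb p P.init π.init (x, y) *
        (π (x (Fin.last H)) (Fin.last H) a * P (x (Fin.last H)) a s' (Fin.last H)) := by
  unfold trajProb
  have h0 : (Fin.snoc (α := fun _ => S) x s' : Fin (H + 2) → S) 0 = x 0 := by
    rw [← Fin.castSucc_zero, Fin.snoc_castSucc]
  simp only [h0, Fin.prod_univ_castSucc (n := H), Fin.snoc_castSucc, Fin.succ_last, Fin.snoc_last,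
    ← Fin.castSucc_succ, Fn'.init, PolicyFn.init, mul_assoc]

theorem sum_traj_succ (F : Traj S A (H + 1) → ℝ) :
    ∑ x, F x = ∑ x : Traj S A H, ∑ a, ∑ s',
      F (Fin.snoc (α := fun _ => S) x.1 s', Fin.snoc (α := fun _ => A) x.2 a) := by
  rw [← ((Fin.snocEquiv fun _ : Fin (H + 2) => S).prodCongr
    (Fin.snocEquiv fun _ : Fin (H + 1) => A)).sum_comp F]
  simp only [Fintype.sum_prod_type, Equiv.prodCongr_apply, Prod.map]
  rw [Finset.sum_comm]
  refine Finset.sum_congr rfl fun x _ => ?_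
  conv_rhs => rw [Finset.sum_comm]
  rw [Finset.sum_comm]
  refine Finset.sum_congr rfl fun a _ => ?_
  rw [Finset.sum_comm]
  rfl

theorem IsPolicy.init {π : PolicyFn S A (H + 1)} (hπ : IsPolicy π) : IsPolicy π.init :=
  ⟨fun s _ a => hπ.1 s _ a, fun s _ => hπ.2 s _⟩

theorem IsKernel.init {P : Fn' S A (H + 1)} (hP : IsKernel P) : IsKernel P.init :=
  ⟨fun s a s' _ => hP.1 s a s' _, fun s a _ => hP.2 s a _⟩

/-- Induction on the horizon, removing the last step. If an earlier state is observed, the last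
action and transition sum to one. If the last state is observed, the last step is absorbed into the
test function of the state before it. -/
theorem sum_trajProb_state (p : S → ℝ) : ∀ {H : ℕ} {P : Fn' S A H} {π : PolicyFn S A H},
    IsKernel P → IsPolicy π → ∀ (k : Fin (H + 1)) (G : S → ℝ),
    ∑ x, trajProb p P π x * G (x.1 k) = ∑ s, stateMarg p P π k s * G s := by
  intro H
  induction H with
  | zero =>
    intro P π _ _ k G
    obtain rfl : k = 0 := Fin.ext (by omega)
    rw [Fintype.sum_prod_type]
    simp only [trajProb, Finset.univ_eq_empty, Finset.prod_empty, mul_one, Finset.sum_const,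
      Finset.card_univ, Fintype.card_unique, one_smul, stateMarg_zero]
    exact (Equiv.funUnique (Fin 1) S).sum_comp (fun s => p s * G s)
  | succ H ih =>
    intro P π hP hπ k G
    rw [sum_traj_succ]
    simp only [trajProb_snoc]
    induction k using Fin.lastCases with
    | cast k =>
      simp only [Fin.snoc_castSucc]
      rw [stateMarg_castSucc, ← ih hP.init hπ.init k G]
      refine Finset.sum_congr rfl fun x _ => ?_
      simp_rw [mul_right_comm _ _ (G _), ← Finset.mul_sum, hP.2, mul_one, hπ.2, mul_one]
    | last =>
      simp only [Fin.snoc_last]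
      have := ih hP.init hπ.init (Fin.last H)
        (fun s => ∑ a, ∑ s', (π s (Fin.last H) a * P s a s' (Fin.last H)) * G s')
      simp only [Finset.mul_sum, ← mul_assoc] at this ⊢
      rw [this, ← stateMarg_castSucc, ← Fin.succ_last]
      simp_rw [stateMarg_succ, Finset.sum_mul]
      conv_rhs => rw [Finset.sum_comm]
      refine Finset.sum_congr rfl fun s _ => ?_
      rw [Finset.sum_comm]

theorem sum_trajProb_step (p : S → ℝ) : ∀ {H : ℕ} {P : Fn' S A H} {π : PolicyFn S A H},
    IsKernel P → IsPolicy π → ∀ (h : Fin H) (G : S → A → S → ℝ),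
    ∑ x, trajProb p P π x * G (x.1 h.castSucc) (x.2 h) (x.1 h.succ) =
      ∑ s, ∑ a, ∑ s', stateMarg p P π h.castSucc s * π s h a * P s a s' h * G s a s' := by
  intro H
  induction H with
  | zero => intro P π _ _ h; exact h.elim0
  | succ H ih =>
    intro P π hP hπ h G
    rw [sum_traj_succ]
    simp only [trajProb_snoc]
    induction h using Fin.lastCases with
    | cast h =>
      simp only [Fin.snoc_castSucc, Fin.succ_castSucc]
      rw [stateMarg_castSucc]
      refine Eq.trans ?_ (ih hP.init hπ.init h G)
      refine Finset.sum_congr rfl fun x _ => ?_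
      simp_rw [mul_right_comm _ _ (G _ _ _), ← Finset.mul_sum, hP.2, mul_one, hπ.2, mul_one]
    | last =>
      simp only [Fin.snoc_castSucc, Fin.succ_last, Fin.snoc_last]
      have := sum_trajProb_state p hP.init hπ.init (Fin.last H)
        (fun s => ∑ a, ∑ s', (π s (Fin.last H) a * P s a s' (Fin.last H)) * G s a s')
      simp only [Finset.mul_sum, ← mul_assoc] at this ⊢
      rw [this, ← stateMarg_castSucc]

theorem stateMarg_nonneg {p : S → ℝ} {P : Fn' S A H} {π : PolicyFn S A H} (hp : ∀ s, 0 ≤ p s)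
    (hP : IsKernel P) (hπ : IsPolicy π) (k : Fin (H + 1)) : ∀ s, 0 ≤ stateMarg p P π k s := by
  induction k using Fin.induction with
  | zero => exact hp
  | succ h ih =>
    intro s
    rw [stateMarg_succ]
    exact Finset.sum_nonneg fun _ _ => Finset.sum_nonneg fun _ _ =>
      mul_nonneg (mul_nonneg (ih _) (hπ.1 _ _ _)) (hP.1 _ _ _ _)

theorem sum_stateMarg {p : S → ℝ} {P : Fn' S A H} {π : PolicyFn S A H} (hp : ∑ s, p s = 1)
    (hP : IsKernel P) (hπ : IsPolicy π) (k : Fin (H + 1)) : ∑ s, stateMarg p P π k s = 1 := by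
  induction k using Fin.induction with
  | zero => exact hp
  | succ h ih =>
    simp_rw [stateMarg_succ]
    rw [Finset.sum_comm]
    simp_rw [Finset.sum_comm (s := (Finset.univ : Finset S)) (t := (Finset.univ : Finset A)),
      ← Finset.mul_sum, hP.2, mul_one]
    rw [Finset.sum_comm]
    simp_rw [← Finset.mul_sum, hπ.2, mul_one, ih]

theorem occBar_eq (p : S → ℝ) {P : Fn' S A H} {π : PolicyFn S A H} (hP : IsKernel P)
    (hπ : IsPolicy π) (s : S) (a : A) (s' : S) (h : Fin H) :
    occBar p P π s a s' h = stateMarg p P π h.castSucc s * π s h a * P s a s' h := by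
  classical
  have := sum_trajProb_step p hP hπ h (fun u b u' => if u = s ∧ b = a ∧ u' = s' then 1 else 0)
  simp only [mul_ite, mul_one, mul_zero] at this
  unfold occBar
  refine Eq.trans (Finset.sum_congr rfl fun x _ => ?_) (this.trans ?_)
  · congr
  · rw [Finset.sum_eq_single s, Finset.sum_eq_single a, Finset.sum_eq_single s'] <;> simp +contextual

theorem occ_eq (p : S → ℝ) {P : Fn' S A H} {π : PolicyFn S A H} (hP : IsKernel P)
    (hπ : IsPolicy π) (s : S) (a : A) (h : Fin H) :
    occ p P π s a h = stateMarg p P π h.castSucc s * π s h a := by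
  simp_rw [occ, occBar_eq p hP hπ, ← Finset.mul_sum, hP.2, mul_one]

theorem occ_nonneg {p : S → ℝ} {P : Fn' S A H} {π : PolicyFn S A H} (hp : ∀ s, 0 ≤ p s)
    (hP : IsKernel P) (hπ : IsPolicy π) (s : S) (a : A) (h : Fin H) : 0 ≤ occ p P π s a h := by
  rw [occ_eq p hP hπ]
  exact mul_nonneg (stateMarg_nonneg hp hP hπ _ _) (hπ.1 _ _ _)

theorem sum_occ {p : S → ℝ} {P : Fn' S A H} {π : PolicyFn S A H} (hp : ∑ s, p s = 1)
    (hP : IsKernel P) (hπ : IsPolicy π) (h : Fin H) : ∑ s, ∑ a, occ p P π s a h = 1 := by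
  simp_rw [occ_eq p hP hπ, ← Finset.mul_sum, hπ.2, mul_one, sum_stateMarg hp hP hπ]

theorem sum_trajProb_visit (p : S → ℝ) {P : Fn' S A H} {π : PolicyFn S A H}
    (hP : IsKernel P) (hπ : IsPolicy π) (h : Fin H) (G : S → A → S → ℝ) :
    ∑ x, trajProb p P π x * G (x.1 h.castSucc) (x.2 h) (x.1 h.succ) =
      ∑ s, ∑ a, occ p P π s a h * ∑ s', P s a s' h * G s a s' := by
  rw [sum_trajProb_step p hP hπ]
  simp_rw [occ_eq p hP hπ, Finset.mul_sum, mul_assoc]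

/-! ### Flows -/

/-- A flow is the occupancy measure of the kernel and the policy that it induces. -/
theorem eq_occ_of_isFlow {p : S → ℝ} {qbar Phat : Fn' S A H} {q : Fn S A H}
    {π : PolicyFn S A H} (hflow : IsFlow p qbar) (hq : ∀ s a h, q s a h = ∑ s', qbar s a s' h)
    (hP : IsKernel Phat) (hind : InducesKernel qbar Phat) (hπ : IsPolicy π)
    (hindπ : InducesPolicy q π) : q = occ p Phat π := by
  have hqb : ∀ s a s' h, 0 ≤ qbar s a s' h := fun s a s' h => (hflow.mem_Icc s a s' h).1
  have hq0 : ∀ s a h, 0 ≤ q s a h := fun s a h => by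
    rw [hq]; exact Finset.sum_nonneg fun _ _ => hqb _ _ _ _
  -- Where the denominator vanishes, all the nonnegative terms vanish, so the factorisation holds
  -- for any version of the kernel; `h2` is the same for the policy.
  have h1 : ∀ s a s' h, qbar s a s' h = q s a h * Phat s a s' h := by
    intro s a s' h
    by_cases h0 : ∑ s'', qbar s a s'' h = 0
    · rw [hq, h0, zero_mul]
      exact (Finset.sum_eq_zero_iff_of_nonneg fun _ _ => hqb _ _ _ _).1 h0 s' (Finset.mem_univ _)
    · rw [hind s a h h0, hq, mul_div_cancel₀ _ h0]
  have h2 : ∀ s a h, q s a h = (∑ b, q s b h) * π s h a := by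
    intro s a h
    by_cases h0 : ∑ b, q s b h = 0
    · rw [h0, zero_mul]
      exact (Finset.sum_eq_zero_iff_of_nonneg fun _ _ => hq0 _ _ _).1 h0 a (Finset.mem_univ _)
    · rw [hindπ s h h0, mul_div_cancel₀ _ h0]
  have h3 : ∀ s h, ∑ s', ∑ a, qbar s a s' h = ∑ b, q s b h := by
    intro s h
    rw [Finset.sum_comm]
    simp_rw [hq]
  -- Flow conservation is the recursion of the state marginals.
  have key : ∀ (n : ℕ) (h : Fin H), (h : ℕ) = n → ∀ s,
      ∑ b, q s b h = stateMarg p Phat π h.castSucc s := by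
    intro n
    induction n with
    | zero =>
      intro h hh s
      have : h.castSucc = 0 := Fin.ext hh
      rw [← h3, hflow.initial s h hh, this, stateMarg_zero]
    | succ n ih =>
      intro h hh s
      let h' : Fin H := ⟨n, by omega⟩
      have : h.castSucc = h'.succ := Fin.ext (by simp [h', hh])
      rw [← h3, hflow.conservation s h h' (by simp [h', hh]), this, stateMarg_succ]
      refine Finset.sum_congr rfl fun u _ => Finset.sum_congr rfl fun a _ => ?_
      rw [h1, h2, ih h' rfl]
  ext s a h
  rw [occ_eq p hP hπ, h2, key h h rfl]

/-! ### Value functions -/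

/-- The value function of `π` for the reward `f` under the kernel `P`. -/
def value (P : Fn' S A H) (π : PolicyFn S A H) (f : Fn S A H) (k : Fin (H + 1)) : S → ℝ :=
  Fin.reverseInduction (motive := fun _ => S → ℝ) (fun _ => 0)
    (fun h v s => ∑ a, π s h a * (f s a h + ∑ s', P s a s' h * v s')) k

theorem value_last (P : Fn' S A H) (π : PolicyFn S A H) (f : Fn S A H) (s : S) :
    value P π f (Fin.last H) s = 0 := by
  simp [value]

theorem value_castSucc (P : Fn' S A H) (π : PolicyFn S A H) (f : Fn S A H) (h : Fin H) (s : S) :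
    value P π f h.castSucc s =
      ∑ a, π s h a * (f s a h + ∑ s', P s a s' h * value P π f h.succ s') := by
  simp [value]

theorem sum_mul_mem_Icc {ι : Type*} [Fintype ι] {w v : ι → ℝ} {b : ℝ} (hw : ∀ i, 0 ≤ w i)
    (hw1 : ∑ i, w i = 1) (hv : ∀ i, v i ∈ Set.Icc 0 b) : ∑ i, w i * v i ∈ Set.Icc 0 b := by
  refine ⟨Finset.sum_nonneg fun i _ => mul_nonneg (hw i) (hv i).1, ?_⟩
  calc ∑ i, w i * v i ≤ ∑ i, w i * b :=
        Finset.sum_le_sum fun i _ => mul_le_mul_of_nonneg_left (hv i).2 (hw i)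
    _ = b := by rw [← Finset.sum_mul, hw1, one_mul]

theorem value_mem {P : Fn' S A H} {π : PolicyFn S A H} {f : Fn S A H} (hP : IsKernel P)
    (hπ : IsPolicy π) (hf : ∀ s a h, f s a h ∈ Set.Icc (0 : ℝ) 1) (k : Fin (H + 1)) :
    ∀ s, value P π f k s ∈ Set.Icc (0 : ℝ) ((H : ℝ) - k) := by
  induction k using Fin.reverseInduction with
  | last => intro s; simp [value_last]
  | cast h ih =>
    intro s
    rw [value_castSucc]
    refine sum_mul_mem_Icc (hπ.1 s h) (hπ.2 s h) fun a => ?_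
    have h1 := sum_mul_mem_Icc (hP.1 s a · h) (hP.2 s a h) ih
    have h2 := hf s a h
    simp only [Fin.val_succ, Nat.cast_add, Nat.cast_one, Fin.val_castSucc, Set.mem_Icc] at h1 h2 ⊢
    constructor <;> linarith [h1.1, h1.2, h2.1, h2.2]

/-- The action value `f + P V`, which lies in `[0, H]`. -/
theorem actionValue_mem {P : Fn' S A H} {π : PolicyFn S A H} {f : Fn S A H} (hP : IsKernel P)
    (hπ : IsPolicy π) (hf : ∀ s a h, f s a h ∈ Set.Icc (0 : ℝ) 1) (s : S) (a : A) (h : Fin H) :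
    f s a h + ∑ s', P s a s' h * value P π f h.succ s' ∈ Set.Icc (0 : ℝ) H := by
  have h1 := sum_mul_mem_Icc (hP.1 s a · h) (hP.2 s a h) (value_mem hP hπ hf h.succ)
  have h2 := hf s a h
  simp only [Fin.val_succ, Nat.cast_add, Nat.cast_one, Set.mem_Icc] at h1 h2 ⊢
  have : (0 : ℝ) ≤ (h : ℕ) := Nat.cast_nonneg _
  constructor <;> linarith [h1.1, h1.2, h2.1, h2.2]

theorem sum_fin_sub_succ (u : Fin (H + 1) → ℝ) :
    ∑ h : Fin H, (u h.castSucc - u h.succ) = u 0 - u (Fin.last H) := by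
  have h1 := Fin.sum_univ_castSucc u
  have h2 := Fin.sum_univ_succ u
  rw [Finset.sum_sub_distrib]
  linarith

theorem sum_stateMarg_succ_mul (p : S → ℝ) {P : Fn' S A H} {π : PolicyFn S A H}
    (hP : IsKernel P) (hπ : IsPolicy π) (h : Fin H) (v : S → ℝ) :
    ∑ s', stateMarg p P π h.succ s' * v s' =
      ∑ s, ∑ a, occ p P π s a h * ∑ s', P s a s' h * v s' := by
  simp_rw [stateMarg_succ, occ_eq p hP hπ, Finset.sum_mul, Finset.mul_sum]
  rw [Finset.sum_comm]
  refine Finset.sum_congr rfl fun s _ => ?_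
  rw [Finset.sum_comm]
  simp_rw [mul_assoc]

theorem sum_stateMarg_castSucc_mul (p : S → ℝ) {P : Fn' S A H} {π : PolicyFn S A H}
    (hP : IsKernel P) (hπ : IsPolicy π) (h : Fin H) (v : S → A → ℝ) :
    ∑ s, stateMarg p P π h.castSucc s * ∑ a, π s h a * v s a =
      ∑ s, ∑ a, occ p P π s a h * v s a := by
  simp_rw [occ_eq p hP hπ, Finset.mul_sum, mul_assoc]

/-- The error that the kernel `Phat` makes in one step on its own value function. -/
def bellmanGap (P Phat : Fn' S A H) (π : PolicyFn S A H) (f : Fn S A H) : Fn S A H :=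
  fun s a h => ∑ s', (Phat s a s' h - P s a s' h) * value Phat π f h.succ s'

theorem pairing_eq_sum_steps (f q : Fn S A H) :
    pairing f q = ∑ h, ∑ s, ∑ a, f s a h * q s a h := by
  unfold pairing
  simp_rw [Finset.sum_comm (s := (Finset.univ : Finset A)) (t := (Finset.univ : Finset (Fin H)))]
  rw [Finset.sum_comm]

/-- The expectation of V at the current state telescopes along the chain of P. Since V solves the
Bellman equation of `Phat`, each difference is the expected reward plus the one-step error. -/
theorem sum_value_zero (p : S → ℝ) {P Phat : Fn' S A H} {π : PolicyFn S A H} (f : Fn S A H)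
    (hP : IsKernel P) (hπ : IsPolicy π) :
    ∑ s, p s * value Phat π f 0 s =
      pairing f (occ p P π) + pairing (bellmanGap P Phat π f) (occ p P π) := by
  have h1 := sum_fin_sub_succ fun k => ∑ s, stateMarg p P π k s * value Phat π f k s
  simp only [value_last, mul_zero, Finset.sum_const_zero, sub_zero, stateMarg_zero] at h1
  rw [← h1, pairing_eq_sum_steps, pairing_eq_sum_steps, ← Finset.sum_add_distrib]
  refine Finset.sum_congr rfl fun h _ => ?_
  simp_rw [value_castSucc]
  rw [sum_stateMarg_castSucc_mul p hP hπ, sum_stateMarg_succ_mul p hP hπ,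
    ← Finset.sum_sub_distrib, ← Finset.sum_add_distrib]
  refine Finset.sum_congr rfl fun s _ => ?_
  rw [← Finset.sum_sub_distrib, ← Finset.sum_add_distrib]
  refine Finset.sum_congr rfl fun a _ => ?_
  simp_rw [bellmanGap, sub_mul, Finset.sum_sub_distrib]
  ring

/-- The performance difference identity. -/
theorem pairing_occ_sub (p : S → ℝ) {P Phat : Fn' S A H} {π : PolicyFn S A H} (f : Fn S A H)
    (hP : IsKernel P) (hPhat : IsKernel Phat) (hπ : IsPolicy π) :
    pairing f (occ p Phat π - occ p P π) = pairing (bellmanGap P Phat π f) (occ p P π) := by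
  -- The same initial value is computed along both kernels; along `Phat` the gap vanishes.
  have h1 := sum_value_zero p (Phat := Phat) f hP hπ
  have h2 := sum_value_zero p (Phat := Phat) f hPhat hπ
  have h3 : pairing (bellmanGap Phat Phat π f) (occ p Phat π) = 0 := by
    simp [pairing, bellmanGap]
  have h4 : pairing f (occ p Phat π - occ p P π)
      = pairing f (occ p Phat π) - pairing f (occ p P π) := by
    simp [pairing, mul_sub, Finset.sum_sub_distrib]
  linarith

/-- The variance of the next value `V_{h+1}(s')` when `s'` is drawn from `P(· ∣ s, a, h)`. -/
def valueVar (P Phat : Fn' S A H) (π : PolicyFn S A H) (f : Fn S A H) : Fn S A H :=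
  fun s a h => ∑ s', P s a s' h *
    (value Phat π f h.succ s' - ∑ u, P s a u h * value Phat π f h.succ u) ^ 2

theorem sum_mul_sub_sq {ι : Type*} [Fintype ι] {w : ι → ℝ} (v : ι → ℝ) (hw1 : ∑ i, w i = 1) :
    ∑ i, w i * (v i - ∑ j, w j * v j) ^ 2 = ∑ i, w i * v i ^ 2 - (∑ j, w j * v j) ^ 2 := by
  set m := ∑ j, w j * v j with hm
  have : ∀ i, w i * (v i - m) ^ 2 = w i * v i ^ 2 - 2 * m * (w i * v i) + m ^ 2 * w i :=
    fun i => by ring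
  simp_rw [this, Finset.sum_add_distrib, Finset.sum_sub_distrib, ← Finset.mul_sum, hw1, ← hm]
  ring

theorem sq_sum_mul_le {ι : Type*} [Fintype ι] {w : ι → ℝ} (v : ι → ℝ) (hw : ∀ i, 0 ≤ w i)
    (hw1 : ∑ i, w i = 1) : (∑ j, w j * v j) ^ 2 ≤ ∑ i, w i * v i ^ 2 := by
  have h1 := sum_mul_sub_sq v hw1
  have h2 : 0 ≤ ∑ i, w i * (v i - ∑ j, w j * v j) ^ 2 :=
    Finset.sum_nonneg fun i _ => mul_nonneg (hw i) (sq_nonneg _)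
  linarith

theorem valueVar_nonneg {P : Fn' S A H} (hP : IsKernel P) (Phat : Fn' S A H)
    (π : PolicyFn S A H) (f : Fn S A H) (s : S) (a : A) (h : Fin H) :
    0 ≤ valueVar P Phat π f s a h :=
  Finset.sum_nonneg fun _ _ => mul_nonneg (hP.1 _ _ _ _) (sq_nonneg _)

/-- A law of total variance for the value function of `Phat` along the kernel `P`. -/
theorem pairing_valueVar_le {p : S → ℝ} {P Phat : Fn' S A H} {π : PolicyFn S A H} {f : Fn S A H}
    (hp : ∀ s, 0 ≤ p s) (hp1 : ∑ s, p s = 1) (hP : IsKernel P) (hPhat : IsKernel Phat)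
    (hπ : IsPolicy π) (hf : ∀ s a h, f s a h ∈ Set.Icc (0 : ℝ) 1) :
    pairing (valueVar P Phat π f) (occ p P π) ≤
      2 * H * (H + pairing (fun s a h => |bellmanGap P Phat π f s a h|) (occ p P π)) := by
  set V := value Phat π f with hV
  have hV0 : ∀ k s, V k s ∈ Set.Icc (0 : ℝ) H := fun k s => by
    have := value_mem hPhat hπ hf k s
    exact ⟨this.1, this.2.trans (by simp)⟩
  have h1 := sum_fin_sub_succ fun k => ∑ s, stateMarg p P π k s * V k s ^ 2
  have h2 : 0 ≤ ∑ s, stateMarg p P π 0 s * V 0 s ^ 2 := Finset.sum_nonneg fun s _ =>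
    mul_nonneg (stateMarg_nonneg hp hP hπ _ _) (sq_nonneg _)
  have h3 : ∑ s, stateMarg p P π (Fin.last H) s * V (Fin.last H) s ^ 2 = 0 := by
    simp [hV, value_last]
  -- The variance is the mean of V² minus the squared mean y. Telescoping V² along P leaves x² - y²,
  -- where x is the action value and Jensen gives V² ≤ mean of x².
  have hterm : ∀ h : Fin H,
      ∑ s, ∑ a, valueVar P Phat π f s a h * occ p P π s a h
        ≤ (2 * H * (1 + ∑ s, ∑ a, |bellmanGap P Phat π f s a h| * occ p P π s a h))
          - (∑ s, stateMarg p P π h.castSucc s * V h.castSucc s ^ 2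
            - ∑ s, stateMarg p P π h.succ s * V h.succ s ^ 2) := by
    intro h
    have hQ : ∑ s, stateMarg p P π h.castSucc s * V h.castSucc s ^ 2 ≤
        ∑ s, ∑ a, occ p P π s a h * (f s a h + ∑ s', Phat s a s' h * V h.succ s') ^ 2 := by
      rw [← sum_stateMarg_castSucc_mul p hP hπ]
      refine Finset.sum_le_sum fun s _ =>
        mul_le_mul_of_nonneg_left ?_ (stateMarg_nonneg hp hP hπ _ _)
      rw [hV, value_castSucc]
      exact sq_sum_mul_le _ (hπ.1 s h) (hπ.2 s h)
    have hone := sum_occ hp1 hP hπ h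
    rw [sum_stateMarg_succ_mul p hP hπ]
    -- Writing 1 as the mass of layer h reduces the claim to one inequality for each (s, a).
    rw [← hone, ← Finset.sum_add_distrib]
    simp_rw [← Finset.sum_add_distrib]
    rw [Finset.mul_sum]
    simp_rw [Finset.mul_sum (s := (Finset.univ : Finset A)) (a := 2 * (H : ℝ))]
    refine le_trans ?_ (sub_le_sub_left (sub_le_sub_right hQ _) _)
    simp_rw [← Finset.sum_sub_distrib]
    refine Finset.sum_le_sum fun s _ => Finset.sum_le_sum fun a _ => ?_
    have hq := occ_nonneg hp hP hπ s a h
    have hvar : valueVar P Phat π f s a h =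
        ∑ s', P s a s' h * V h.succ s' ^ 2 - (∑ s', P s a s' h * V h.succ s') ^ 2 :=
      sum_mul_sub_sq _ (hP.2 s a h)
    have hgap : bellmanGap P Phat π f s a h =
        ∑ s', Phat s a s' h * V h.succ s' - ∑ s', P s a s' h * V h.succ s' := by
      simp_rw [bellmanGap, sub_mul, Finset.sum_sub_distrib]
      rfl
    have hQ1 := actionValue_mem hPhat hπ hf s a h
    have hPV := sum_mul_mem_Icc (hP.1 s a · h) (hP.2 s a h) (hV0 h.succ)
    have hf1 := hf s a h
    rw [hvar]
    rw [← hV] at hQ1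
    set x := f s a h + ∑ s', Phat s a s' h * V h.succ s' with hx
    set y := ∑ s', P s a s' h * V h.succ s' with hy
    set D := bellmanGap P Phat π f s a h with hD
    -- Here x - y is the reward plus the gap.
    have hxy : x - y ≤ 1 + |D| := by
      have := le_abs_self D
      have := hf1.2
      rw [hx]; linarith
    have key : x ^ 2 - y ^ 2 ≤ 2 * H * (1 + |D|) := by
      have h0 : (x - y) * (x + y) ≤ (1 + |D|) * (x + y) :=
        mul_le_mul_of_nonneg_right hxy (add_nonneg hQ1.1 hPV.1)
      have h00 : (1 + |D|) * (x + y) ≤ (1 + |D|) * (2 * H) :=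
        mul_le_mul_of_nonneg_left (by linarith [hQ1.2, hPV.2]) (by positivity)
      nlinarith
    nlinarith [mul_le_mul_of_nonneg_left key hq]
  rw [pairing_eq_sum_steps, pairing_eq_sum_steps]
  refine (Finset.sum_le_sum fun h _ => hterm h).trans ?_
  rw [Finset.sum_sub_distrib, ← Finset.mul_sum, Finset.sum_add_distrib, h1, h3]
  simp only [Finset.sum_const, Finset.card_univ, Fintype.card_fin, nsmul_eq_mul, mul_one]
  linarith

/-! ### Visit counts -/

open Classical in
theorem visits_eq_sum (X : ℕ → Traj S A H) (t : ℕ) (s : S) (a : A) (h : Fin H) :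
    (visits X t s a h : ℝ) =
      ∑ i ∈ Finset.range t, if (X i).1 h.castSucc = s ∧ (X i).2 h = a then 1 else 0 := by
  simp [visits]

open Classical in
theorem visits'_eq_sum (X : ℕ → Traj S A H) (t : ℕ) (s : S) (a : A) (s' : S) (h : Fin H) :
    (visits' X t s a s' h : ℝ) =
      ∑ i ∈ Finset.range t,
        if (X i).1 h.castSucc = s ∧ (X i).2 h = a ∧ (X i).1 h.succ = s' then 1 else 0 := by
  simp [visits']

theorem visits_le (X : ℕ → Traj S A H) (t : ℕ) (s : S) (a : A) (h : Fin H) :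
    visits X t s a h ≤ t := by
  classical
  unfold visits
  exact (Finset.card_filter_le _ _).trans (by simp)

theorem visits'_le_visits (X : ℕ → Traj S A H) (t : ℕ) (s : S) (a : A) (s' : S) (h : Fin H) :
    visits' X t s a s' h ≤ visits X t s a h := by
  classical
  unfold visits' visits
  refine Finset.card_le_card fun i hi => ?_
  simp only [Finset.mem_filter] at hi ⊢
  tauto

/-- The logarithmic increment is at least 1/(n+2), and n + 2 ≤ 3 max(1, n), with equality at n = 1.
-/
theorem inv_max_le_log_sub (n : ℕ) :
    (max 1 (n : ℝ))⁻¹ ≤ 3 * (Real.log (n + 1 + 1) - Real.log (n + 1)) := by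
  have hn : (0 : ℝ) ≤ n := n.cast_nonneg
  have h1 : 1 / ((n : ℝ) + 2) ≤ Real.log (n + 1 + 1) - Real.log (n + 1) := by
    rw [← Real.log_div (by positivity) (by positivity)]
    refine le_trans (le_of_eq ?_) (Real.one_sub_inv_le_log_of_pos (by positivity))
    field_simp
    ring
  refine le_trans ?_ (mul_le_mul_of_nonneg_left h1 (by norm_num))
  rw [mul_one_div, inv_eq_one_div, div_le_div_iff₀ (by positivity) (by positivity)]
  rcases Nat.eq_zero_or_pos n with rfl | hpos
  · norm_num
  · have : (1 : ℝ) ≤ n := by exact_mod_cast hpos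
    rw [max_eq_right this]
    linarith

open Classical in
/-- The harmonic sum over the visits to a state-action pair. -/
theorem sum_visit_inv_le (X : ℕ → Traj S A H) (t : ℕ) (s : S) (a : A) (h : Fin H) :
    ∑ i ∈ Finset.range t, (max 1 (visits X i s a h : ℝ))⁻¹ *
        (if (X i).1 h.castSucc = s ∧ (X i).2 h = a then 1 else 0)
      ≤ 3 * Real.log (visits X t s a h + 1) := by
  induction t with
  | zero => simp [visits]
  | succ t ih =>
    have h1 := visits_eq_sum X (t + 1) s a h
    rw [Finset.sum_range_succ, ← visits_eq_sum X t s a h] at h1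
    rw [Finset.sum_range_succ, h1]
    split_ifs with hv
    · have := inv_max_le_log_sub (visits X t s a h)
      linarith
    · simpa using ih

/-! ### Exponential supermartingales -/

section Run

variable {Ω : Type*} [mΩ : MeasurableSpace Ω] {μ : Measure Ω} {p : S → ℝ} {P : Fn' S A H}
  {astar : A} {T : ℕ} {ρ δ η : ℝ} {ψ : ℝ → ℝ} {ℱ : Filtration ℕ mΩ} {f g : ℕ → Ω → Fn S A H}
  {X : ℕ → Ω → Traj S A H} {lam : ℕ → Ω → ℝ} {qhat : ℕ → Ω → Fn S A H}
  {π : ℕ → Ω → PolicyFn S A H}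

theorem IsRun.measurable_comp_traj (hrun : IsRun μ p P astar T ρ δ η ψ ℱ f g X lam qhat π)
    {t : ℕ} (ht : t < T) {φ : Ω → Traj S A H → ℝ}
    (hφ : ∀ x, Measurable[ℱ (t + 1)] fun ω => φ ω x) :
    Measurable[ℱ (t + 1)] fun ω => φ ω (X t ω) := by
  classical
  have : (fun ω => φ ω (X t ω)) =
      fun ω => ∑ x, Set.indicator {ω | X t ω = x} (fun ω => φ ω x) ω := by
    ext ω
    rw [Finset.sum_eq_single (X t ω)] <;> simp +contextual [eq_comm]
  rw [this]
  exact Finset.measurable_sum _ fun x _ => (hφ x).indicator (hrun.X_meas t ht x)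

/-- Given `ℱ t`, the factor of episode t has mean at most one, so the products form a
supermartingale. The bound B provides integrability. -/
theorem IsRun.integral_prod_le_one [IsProbabilityMeasure μ]
    (hrun : IsRun μ p P astar T ρ δ η ψ ℱ f g X lam qhat π)
    {φ : ℕ → Ω → Traj S A H → ℝ} {B : ℝ}
    (hφ : ∀ t < T, ∀ x, Measurable[ℱ t] fun ω => φ t ω x)
    (h0 : ∀ t < T, ∀ ω x, 0 ≤ φ t ω x) (hB : ∀ t < T, ∀ ω x, φ t ω x ≤ B)
    (h1 : ∀ t < T, ∀ ω, ∑ x, trajProb p P (π t ω) x * φ t ω x ≤ 1) :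
    ∀ t ≤ T, Integrable (fun ω => ∏ i ∈ Finset.range t, φ i ω (X i ω)) μ ∧
      ∫ ω, ∏ i ∈ Finset.range t, φ i ω (X i ω) ∂μ ≤ 1 := by
  classical
  set G : ℕ → Ω → ℝ := fun t ω => ∏ i ∈ Finset.range t, φ i ω (X i ω) with hG
  have hGm : ∀ t ≤ T, Measurable[ℱ t] (G t) := fun t ht =>
    Finset.measurable_prod _ fun i hi => by
      have hi := Finset.mem_range.1 hi
      exact (hrun.measurable_comp_traj (hi.trans_le ht)
        fun x => (hφ i (hi.trans_le ht) x).mono (ℱ.mono (Nat.le_succ i)) le_rfl).mono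
          (ℱ.mono hi) le_rfl
  have hG0 : ∀ t ≤ T, ∀ ω, 0 ≤ G t ω := fun t ht ω => Finset.prod_nonneg fun i hi =>
    h0 i ((Finset.mem_range.1 hi).trans_le ht) _ _
  have hGB : ∀ t ≤ T, ∀ ω, G t ω ≤ B ^ t := fun t ht ω =>
    (Finset.prod_le_prod (fun i hi => h0 i ((Finset.mem_range.1 hi).trans_le ht) _ _)
      fun i hi => hB i ((Finset.mem_range.1 hi).trans_le ht) _ _).trans (by simp)
  have hGi : ∀ t ≤ T, Integrable (G t) μ := fun t ht =>
    Integrable.of_bound (((hGm t ht).mono (ℱ.le t) le_rfl).aestronglyMeasurable) (B ^ t)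
      (Filter.Eventually.of_forall fun ω => by
        rw [Real.norm_of_nonneg (hG0 t ht ω)]; exact hGB t ht ω)
  intro t ht
  refine ⟨hGi t ht, ?_⟩
  induction t with
  | zero => simp
  | succ t ih =>
    have ht' : t < T := ht
    set I : Traj S A H → Ω → ℝ := fun x => Set.indicator {ω | X t ω = x} fun _ => (1 : ℝ) with hI
    set W : Traj S A H → Ω → ℝ := fun x ω => G t ω * φ t ω x with hW
    have hWm : ∀ x, Measurable[ℱ t] (W x) := fun x => (hGm t ht'.le).mul (hφ t ht' x)
    have hset : ∀ x, MeasurableSet {ω | X t ω = x} := fun x =>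
      ℱ.le (t + 1) _ (hrun.X_meas t ht' x)
    have hIi : ∀ x, Integrable (I x) μ := fun x => (integrable_const 1).indicator (hset x)
    have hWI : ∀ x, Integrable (W x * I x) μ := fun x => by
      refine Integrable.of_bound (C := B ^ t * B) ?_ (Filter.Eventually.of_forall fun ω => ?_)
      · exact (((hWm x).mono (ℱ.le t) le_rfl).mul
          (measurable_const.indicator (hset x))).aestronglyMeasurable
      · have hw0 : 0 ≤ W x ω := mul_nonneg (hG0 t ht'.le ω) (h0 t ht' ω x)
        have hwB : W x ω ≤ B ^ t * B := mul_le_mul (hGB t ht'.le ω) (hB t ht' ω x)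
          (h0 t ht' ω x) ((hG0 t ht'.le ω).trans (hGB t ht'.le ω))
        by_cases hx : X t ω = x
        · simpa [hI, hx, abs_of_nonneg hw0] using hwB
        · simpa [hI, hx] using hw0.trans hwB
    -- Splitting over the finitely many trajectories separates an `ℱ t`-measurable weight from an
    -- indicator whose conditional expectation is `X_law`.
    have hdec : G (t + 1) = fun ω => ∑ x, (W x * I x) ω := by
      ext ω
      rw [Finset.sum_eq_single (X t ω)]
      · simp [hG, hW, hI, Finset.prod_range_succ]
      · intro x _ hx
        simp [hI, hx.symm]
      · simp
    have hpull : ∀ x, μ[W x * I x | ℱ t] =ᵐ[μ] fun ω => W x ω * trajProb p P (π t ω) x :=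
      fun x => by
        filter_upwards [condExp_mul_of_stronglyMeasurable_left (hWm x).stronglyMeasurable (hWI x)
          (hIi x), hrun.X_law t ht' x] with ω hω1 hω2
        rw [hω1, Pi.mul_apply, hω2]
    have hint : ∀ x, Integrable (fun ω => W x ω * trajProb p P (π t ω) x) μ := fun x =>
      integrable_condExp.congr (hpull x)
    have hval : ∀ x, ∫ ω, (W x * I x) ω ∂μ = ∫ ω, W x ω * trajProb p P (π t ω) x ∂μ := fun x => by
      rw [← integral_congr_ae (hpull x), integral_condExp (ℱ.le t)]
    rw [show (∫ ω, ∏ i ∈ Finset.range (t + 1), φ i ω (X i ω) ∂μ) = ∫ ω, G (t + 1) ω ∂μ from rfl,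
      hdec, integral_finsetSum _ fun x _ => hWI x]
    simp_rw [hval]
    rw [← integral_finsetSum _ fun x _ => hint x]
    refine (integral_mono (integrable_finsetSum _ fun x _ => hint x) (hGi t ht'.le)
      fun ω => ?_).trans (ih ht'.le)
    calc ∑ x, W x ω * trajProb p P (π t ω) x
        = G t ω * ∑ x, trajProb p P (π t ω) x * φ t ω x := by
          rw [Finset.mul_sum]
          exact Finset.sum_congr rfl fun x _ => by simp only [hW]; ring
      _ ≤ G t ω * 1 := mul_le_mul_of_nonneg_left (h1 t ht' ω) (hG0 t ht'.le ω)
      _ = G t ω := mul_one _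

/-- Chernoff bound for sums whose increments have conditional exponential moment at most one. -/
theorem IsRun.measureReal_le_exp [IsProbabilityMeasure μ]
    (hrun : IsRun μ p P astar T ρ δ η ψ ℱ f g X lam qhat π)
    {φ : ℕ → Ω → Traj S A H → ℝ} {B : ℝ}
    (hφ : ∀ t < T, ∀ x, Measurable[ℱ t] fun ω => φ t ω x)
    (hB : ∀ t < T, ∀ ω x, φ t ω x ≤ B)
    (h1 : ∀ t < T, ∀ ω, ∑ x, trajProb p P (π t ω) x * Real.exp (φ t ω x) ≤ 1)
    {t : ℕ} (ht : t ≤ T) (c : ℝ) :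
    μ.real {ω | c ≤ ∑ i ∈ Finset.range t, φ i ω (X i ω)} ≤ Real.exp (-c) := by
  obtain ⟨hi, hle⟩ := hrun.integral_prod_le_one (φ := fun t ω x => Real.exp (φ t ω x))
    (B := Real.exp B) (fun t ht x => Real.measurable_exp.comp (hφ t ht x))
    (fun _ _ _ _ => (Real.exp_pos _).le) (fun t ht ω x => Real.exp_le_exp.2 (hB t ht ω x)) h1 t ht
  have hm := mul_meas_ge_le_integral_of_nonneg (μ := μ)
    (Filter.Eventually.of_forall fun ω => Finset.prod_nonneg fun i _ => (Real.exp_pos _).le)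
    hi (Real.exp c)
  simp_rw [← Real.exp_sum, Real.exp_le_exp] at hm hle
  rw [Real.exp_neg, ← one_div, le_div_iff₀' (Real.exp_pos c)]
  exact hm.trans hle

theorem sum_trajProb_visit_le_one {π : PolicyFn S A H} (hM : IsMDP p P) (hπ : IsPolicy π)
    (h : Fin H) {G : S → A → S → ℝ} (hG : ∀ s a, ∑ s', P s a s' h * G s a s' ≤ 1) :
    ∑ x, trajProb p P π x * G (x.1 h.castSucc) (x.2 h) (x.1 h.succ) ≤ 1 := by
  rw [sum_trajProb_visit p hM.kernel hπ, ← sum_occ hM.init_sum hM.kernel hπ h]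
  refine Finset.sum_le_sum fun s _ => Finset.sum_le_sum fun a _ => ?_
  exact mul_le_of_le_one_right (occ_nonneg hM.init_nonneg hM.kernel hπ s a h) (hG s a)

/-- Deviation of the transition counts, at a fixed exponential tilt. -/
theorem IsRun.measureReal_transition_le [IsProbabilityMeasure μ] (hM : IsMDP p P)
    (hrun : IsRun μ p P astar T ρ δ η ψ ℱ f g X lam qhat π) {t : ℕ} (ht : t ≤ T)
    (s : S) (a : A) (s' : S) (h : Fin H) {θ : ℝ} (hθ : |θ| ≤ 1) (c : ℝ) :
    μ.real {ω | c ≤ θ * ((visits' (fun i => X i ω) t s a s' h : ℝ)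
          - P s a s' h * visits (fun i => X i ω) t s a h)
        - θ ^ 2 * (P s a s' h * visits (fun i => X i ω) t s a h)} ≤ Real.exp (-c) := by
  classical
  -- As e^θ ≤ 1 + θ + θ² for |θ| ≤ 1, an indicator of mean P has exponential moment at most 1 + κP ≤
  -- e^{κP}, which the compensator κP cancels.
  set κ := θ + θ ^ 2 with hκ
  set G : S → A → S → ℝ := fun u b u' =>
    if u = s ∧ b = a then (θ * if u' = s' then 1 else 0) - κ * P s a s' h else 0 with hGdef
  have hbd : ∀ u b u', G u b u' ≤ ∑ u, ∑ b, ∑ u', |G u b u'| := fun u b u' => by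
    refine (le_abs_self _).trans ?_
    refine le_trans ?_ (Finset.single_le_sum (f := fun u => ∑ b, ∑ u', |G u b u'|)
      (fun _ _ => by positivity) (Finset.mem_univ u))
    refine le_trans ?_ (Finset.single_le_sum (f := fun b => ∑ u', |G u b u'|)
      (fun _ _ => by positivity) (Finset.mem_univ b))
    exact Finset.single_le_sum (f := fun u' => |G u b u'|)
      (fun _ _ => by positivity) (Finset.mem_univ u')
  have hexp : ∀ u b, ∑ u', P u b u' h * Real.exp (G u b u') ≤ 1 := by
    intro u b
    by_cases hub : u = s ∧ b = a
    · obtain ⟨rfl, rfl⟩ := hub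
      have hstep : ∀ u', Real.exp (G u b u') ≤
          (1 + κ * if u' = s' then 1 else 0) * Real.exp (-(κ * P u b s' h)) := by
        intro u'
        simp only [hGdef, and_self, if_true]
        rw [sub_eq_add_neg, Real.exp_add]
        refine mul_le_mul_of_nonneg_right ?_ (Real.exp_pos _).le
        split_ifs
        · have := (abs_le.1 (Real.abs_exp_sub_one_sub_id_le hθ)).2
          rw [mul_one, mul_one]; linarith
        · simp
      calc ∑ u', P u b u' h * Real.exp (G u b u')
          ≤ ∑ u', P u b u' h *
              ((1 + κ * if u' = s' then 1 else 0) * Real.exp (-(κ * P u b s' h))) :=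
            Finset.sum_le_sum fun u' _ =>
              mul_le_mul_of_nonneg_left (hstep u') (hM.kernel.1 _ _ _ _)
        _ = (κ * P u b s' h + 1) * Real.exp (-(κ * P u b s' h)) := by
            simp_rw [← mul_assoc, ← Finset.sum_mul, mul_add, Finset.sum_add_distrib, mul_one,
              hM.kernel.2]
            simp
            ring
        _ ≤ Real.exp (κ * P u b s' h) * Real.exp (-(κ * P u b s' h)) :=
            mul_le_mul_of_nonneg_right (Real.add_one_le_exp _) (Real.exp_pos _).le
        _ = 1 := by rw [← Real.exp_add]; simp
    · simp [hGdef, hub, hM.kernel.2]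
  have := hrun.measureReal_le_exp
    (φ := fun _ _ x => G (x.1 h.castSucc) (x.2 h) (x.1 h.succ))
    (fun _ _ _ => measurable_const) (fun _ _ _ _ => hbd _ _ _)
    (fun i hi ω => sum_trajProb_visit_le_one hM (hrun.π_policy i hi ω) h
      (G := fun u b u' => Real.exp (G u b u')) hexp) ht c
  refine le_trans (le_of_eq ?_) this
  congr 1
  ext ω
  have : ∑ i ∈ Finset.range t,
      G ((X i ω).1 h.castSucc) ((X i ω).2 h) ((X i ω).1 h.succ) =
      θ * ((visits' (fun i => X i ω) t s a s' h : ℝ)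
          - P s a s' h * visits (fun i => X i ω) t s a h)
        - θ ^ 2 * (P s a s' h * visits (fun i => X i ω) t s a h) := by
    rw [visits_eq_sum, visits'_eq_sum]
    simp_rw [Finset.mul_sum, ← Finset.sum_sub_distrib, Finset.mul_sum, ← Finset.sum_sub_distrib]
    refine Finset.sum_congr rfl fun i _ => ?_
    simp only [hGdef, ← and_assoc]
    by_cases h1 : (X i ω).1 h.castSucc = s ∧ (X i ω).2 h = a
    · simp only [h1, and_self, true_and, if_true, hκ]; ring
    · simp [h1]
  simp only [Set.mem_ofPred_eq, this]

theorem IsRun.measurable_visits (hrun : IsRun μ p P astar T ρ δ η ψ ℱ f g X lam qhat π)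
    {t : ℕ} (ht : t ≤ T) (s : S) (a : A) (h : Fin H) :
    Measurable[ℱ t] fun ω => (visits (fun i => X i ω) t s a h : ℝ) := by
  classical
  simp_rw [visits_eq_sum]
  refine Finset.measurable_sum _ fun i hi => ?_
  have hi := Finset.mem_range.1 hi
  exact (hrun.measurable_comp_traj (hi.trans_le ht)
    (φ := fun _ x => if x.1 h.castSucc = s ∧ x.2 h = a then 1 else 0)
    fun x => measurable_const).mono (ℱ.mono hi) le_rfl

theorem IsRun.measurable_occ (hrun : IsRun μ p P astar T ρ δ η ψ ℱ f g X lam qhat π)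
    {t : ℕ} (ht : t < T) (s : S) (a : A) (h : Fin H) :
    Measurable[ℱ t] fun ω => occ p P (π t ω) s a h := by
  classical
  unfold occ occBar trajProb
  refine Finset.measurable_sum _ fun s' _ => Finset.measurable_sum _ fun x _ => ?_
  split_ifs
  · refine measurable_const.mul (Finset.measurable_prod _ fun k _ => ?_)
    exact (hrun.π_meas t ht _ _ _).mul measurable_const
  · exact measurable_const

theorem half_le_one_sub_exp_neg {x : ℝ} (h0 : 0 ≤ x) (h1 : x ≤ 1) :
    x / 2 ≤ 1 - Real.exp (-x) := by
  have h2 : Real.exp (-x) ≤ (1 + x)⁻¹ := by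
    rw [Real.exp_neg]
    exact inv_anti₀ (by linarith) (by linarith [Real.add_one_le_exp x])
  have h3 : (1 + x)⁻¹ ≤ 1 - x / 2 := by
    rw [inv_le_iff_one_le_mul₀ (by linarith)]
    nlinarith
  linarith

theorem occ_le_one {π : PolicyFn S A H} (hM : IsMDP p P) (hπ : IsPolicy π)
    (s : S) (a : A) (h : Fin H) : occ p P π s a h ≤ 1 := by
  have h0 := occ_nonneg hM.init_nonneg hM.kernel hπ
  rw [← sum_occ hM.init_sum hM.kernel hπ h]
  exact (Finset.single_le_sum (f := fun a => occ p P π s a h) (fun _ _ => h0 _ _ _)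
    (Finset.mem_univ a)).trans (Finset.single_le_sum (f := fun s => ∑ a, occ p P π s a h)
      (fun _ _ => Finset.sum_nonneg fun _ _ => h0 _ _ _) (Finset.mem_univ s))

open Classical in
/-- The expected inverse visit counts are dominated by the realised ones. -/
theorem IsRun.measureReal_occ_le [IsProbabilityMeasure μ] (hM : IsMDP p P)
    (hrun : IsRun μ p P astar T ρ δ η ψ ℱ f g X lam qhat π) (s : S) (a : A) (h : Fin H) (c : ℝ) :
    μ.real {ω | c ≤ ∑ t ∈ Finset.range T,
      ((max 1 (visits (fun i => X i ω) t s a h : ℝ))⁻¹ * occ p P (π t ω) s a h / 2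
        - (max 1 (visits (fun i => X i ω) t s a h : ℝ))⁻¹ *
          (if (X t ω).1 h.castSucc = s ∧ (X t ω).2 h = a then 1 else 0))} ≤ Real.exp (-c) := by
  set w : ℕ → Ω → ℝ := fun t ω => (max 1 (visits (fun i => X i ω) t s a h : ℝ))⁻¹ with hw
  have hw0 : ∀ t ω, 0 ≤ w t ω := fun t ω => by positivity
  have hw1 : ∀ t ω, w t ω ≤ 1 := fun t ω => inv_le_one_of_one_le₀ (le_max_left _ _)
  have hwm : ∀ t < T, Measurable[ℱ t] (w t) := fun t ht =>
    (measurable_const.max (hrun.measurable_visits ht.le s a h)).inv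
  refine hrun.measureReal_le_exp (B := 1)
    (φ := fun t ω x => w t ω * occ p P (π t ω) s a h / 2
      - w t ω * (if x.1 h.castSucc = s ∧ x.2 h = a then 1 else 0)) ?_ ?_ ?_ le_rfl c
  · intro t ht x
    exact (((hwm t ht).mul (hrun.measurable_occ ht s a h)).div_const 2).sub
      ((hwm t ht).mul measurable_const)
  · intro t ht ω x
    have h1 := mul_le_mul (hw1 t ω) (occ_le_one hM (hrun.π_policy t ht ω) s a h)
      (occ_nonneg hM.init_nonneg hM.kernel (hrun.π_policy t ht ω) s a h) zero_le_one
    have h2 : 0 ≤ w t ω * (if x.1 h.castSucc = s ∧ x.2 h = a then 1 else 0) :=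
      mul_nonneg (hw0 t ω) (by positivity)
    linarith
  · intro t ht ω
    have hπ := hrun.π_policy t ht ω
    set q := occ p P (π t ω) s a h with hq
    have hq0 : 0 ≤ q := occ_nonneg hM.init_nonneg hM.kernel hπ s a h
    -- The exponential of -w times an indicator is 1 - b times it, with mean 1 - bq ≤ e^{-bq}. Since
    -- b ≥ w/2 for w in [0, 1], this absorbs e^{wq/2}: hence the factor 1/2 in the statement.
    set b := 1 - Real.exp (-(w t ω)) with hb
    have hsum := sum_trajProb_visit p hM.kernel hπ h
      (fun u v _ => (1 - b * if u = s ∧ v = a then 1 else 0) * Real.exp (w t ω * q / 2))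
    have hval : ∀ x : Traj S A H, Real.exp (w t ω * q / 2
        - w t ω * (if x.1 h.castSucc = s ∧ x.2 h = a then 1 else 0)) =
        (1 - b * if x.1 h.castSucc = s ∧ x.2 h = a then 1 else 0) *
          Real.exp (w t ω * q / 2) := by
      intro x
      rw [sub_eq_neg_add, Real.exp_add]
      congr 1
      split_ifs <;> simp [hb]
    simp_rw [hval]
    rw [hsum]
    simp_rw [← Finset.sum_mul, hM.kernel.2, one_mul, ← mul_assoc, ← Finset.sum_mul, mul_sub,
      Finset.sum_sub_distrib, mul_one, sum_occ hM.init_sum hM.kernel hπ h]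
    have hone : ∑ u, ∑ v, occ p P (π t ω) u v h * (b * if u = s ∧ v = a then 1 else 0) = b * q := by
      rw [Finset.sum_eq_single s, Finset.sum_eq_single a] <;> simp +contextual [hq, mul_comm]
    rw [hone]
    have hbw : w t ω / 2 ≤ b := half_le_one_sub_exp_neg (hw0 t ω) (hw1 t ω)
    calc (1 - b * q) * Real.exp (w t ω * q / 2)
        ≤ Real.exp (-(b * q)) * Real.exp (w t ω * q / 2) :=
          mul_le_mul_of_nonneg_right (Real.one_sub_le_exp_neg _) (Real.exp_pos _).le
      _ ≤ 1 := by
          rw [← Real.exp_add, Real.exp_le_one_iff]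
          nlinarith [mul_le_mul_of_nonneg_right hbw hq0]

end Run

/-! ### The good event -/

/-- The transition counts are within a Bernstein radius of their conditional means. -/
def CountsConcentrate (P : Fn' S A H) (T : ℕ) (L : ℝ) (X : ℕ → Traj S A H) : Prop :=
  ∀ t < T, ∀ s a s' h,
    |(visits' X t s a s' h : ℝ) - P s a s' h * visits X t s a h| ≤
      3 * (√(P s a s' h * visits X t s a h * L) + L)

/-- The tilt balances the two terms and is clipped at 1. If x ≥ L, then θ²x = L and θ√(xL) = L, so
θ|m| < 3L gives the bound; if x ≤ L, then θ = 1 and |m| < 2L + x ≤ 3L. -/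
theorem abs_le_of_tilts {m x L : ℝ} (hL : 0 < L)
    (hpos : √(L / max L x) * m - √(L / max L x) ^ 2 * x < 2 * L)
    (hneg : -√(L / max L x) * m - (-√(L / max L x)) ^ 2 * x < 2 * L) :
    |m| ≤ 3 * (√(x * L) + L) := by
  rcases le_total x L with hxL | hxL
  · rw [max_eq_left hxL, div_self hL.ne', Real.sqrt_one] at hpos hneg
    have := Real.sqrt_nonneg (x * L)
    rw [abs_le]
    constructor <;> linarith
  · rw [max_eq_right hxL] at hpos hneg
    have h0 : 0 < x := hL.trans_le hxL
    set θ := √(L / x) with hθ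
    have hθ0 : 0 < θ := Real.sqrt_pos.2 (div_pos hL h0)
    have hθ2 : θ ^ 2 * x = L := by
      rw [hθ, Real.sq_sqrt (div_pos hL h0).le, div_mul_cancel₀ _ h0.ne']
    have hθs : θ * √(x * L) = L := by
      rw [hθ, ← Real.sqrt_mul (div_pos hL h0).le]
      rw [show L / x * (x * L) = L ^ 2 by field_simp, Real.sqrt_sq hL.le]
    rw [neg_sq, hθ2] at hneg
    rw [hθ2] at hpos
    have h3 : θ * |m| ≤ θ * (3 * √(x * L)) := by
      rw [mul_left_comm, hθs]
      rcases abs_cases m with ⟨h, _⟩ | ⟨h, _⟩ <;> rw [h] <;> linarith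
    have := le_of_mul_le_mul_left h3 hθ0
    linarith

/-- All rests on HSAT/δ ≥ 4T, which exceeds e and is at least T + 1. -/
theorem logFactor_facts [Nonempty S] [Nonempty A] {T : ℕ} {δ : ℝ} (hH : 0 < H) (hT : 0 < T)
    (hδ : 0 < δ) (hδ4 : δ < 1 / 4) :
    1 ≤ logFactor S A H T δ ∧ Real.log ((T : ℝ) + 1) ≤ logFactor S A H T δ ∧
      Real.exp (-logFactor S A H T δ) =
        δ / ((H : ℝ) * Fintype.card S * Fintype.card A * T) := by
  have h1 : (1 : ℝ) ≤ H := by exact_mod_cast hH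
  have h2 : (1 : ℝ) ≤ T := by exact_mod_cast hT
  have h3 : (1 : ℝ) ≤ Fintype.card S := by exact_mod_cast Fintype.card_pos
  have h4 : (1 : ℝ) ≤ Fintype.card A := by exact_mod_cast Fintype.card_pos
  have h5 : (T : ℝ) ≤ (H : ℝ) * Fintype.card S * Fintype.card A * T :=
    le_mul_of_one_le_left (by linarith) (one_le_mul_of_one_le_of_one_le
      (one_le_mul_of_one_le_of_one_le h1 h3) h4)
  have h6 : 4 * (T : ℝ) ≤ (H : ℝ) * Fintype.card S * Fintype.card A * T / δ := by
    rw [le_div_iff₀ hδ]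
    nlinarith
  refine ⟨?_, ?_, ?_⟩
  · rw [logFactor, Real.le_log_iff_exp_le (by linarith)]
    linarith [Real.exp_one_lt_d9]
  · exact Real.log_le_log (by linarith) (by linarith)
  · rw [Real.exp_neg, logFactor, Real.exp_log (by linarith), inv_div]

section Run

variable {Ω : Type*} [mΩ : MeasurableSpace Ω] {μ : Measure Ω} {p : S → ℝ} {P : Fn' S A H}
  {astar : A} {T : ℕ} {ρ δ η : ℝ} {ψ : ℝ → ℝ} {ℱ : Filtration ℕ mΩ} {f g : ℕ → Ω → Fn S A H}
  {X : ℕ → Ω → Traj S A H} {lam : ℕ → Ω → ℝ} {qhat : ℕ → Ω → Fn S A H}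
  {π : ℕ → Ω → PolicyFn S A H}

/-- The best tilt depends on the random visit count, so the union bound also runs over the possible
values of that count (the first `Fin T`), besides the episode, the transition and the sign. -/
theorem IsRun.measureReal_not_countsConcentrate_le [IsProbabilityMeasure μ] (hM : IsMDP p P)
    (hrun : IsRun μ p P astar T ρ δ η ψ ℱ f g X lam qhat π) {L : ℝ} (hL : 0 < L) :
    μ.real {ω | ¬ CountsConcentrate P T L fun i => X i ω} ≤
      2 * (T : ℝ) ^ 2 * Fintype.card S ^ 2 * Fintype.card A * H * Real.exp (-(2 * L)) := by
  let ι := Fin T × Fin T × (S × A × S × Fin H) × Bool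
  let θ : ι → ℝ := fun k =>
    (if k.2.2.2 then 1 else -1) *
      √(L / max L (P k.2.2.1.1 k.2.2.1.2.1 k.2.2.1.2.2.1 k.2.2.1.2.2.2 * (k.1 : ℕ)))
  have hθ : ∀ k, |θ k| ≤ 1 := fun k => by
    have h0 := Real.sqrt_le_one.2 ((div_le_one (lt_max_of_lt_left hL)).2 (le_max_left L
      (P k.2.2.1.1 k.2.2.1.2.1 k.2.2.1.2.2.1 k.2.2.1.2.2.2 * (k.1 : ℕ))))
    rw [← abs_of_nonneg (Real.sqrt_nonneg _)] at h0
    simp only [θ, abs_mul]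
    split_ifs <;> simpa using h0
  let E : ι → Set Ω := fun k => {ω | 2 * L ≤
    θ k * ((visits' (fun i => X i ω) k.2.1 k.2.2.1.1 k.2.2.1.2.1 k.2.2.1.2.2.1 k.2.2.1.2.2.2 : ℝ)
        - P k.2.2.1.1 k.2.2.1.2.1 k.2.2.1.2.2.1 k.2.2.1.2.2.2 *
          visits (fun i => X i ω) k.2.1 k.2.2.1.1 k.2.2.1.2.1 k.2.2.1.2.2.2)
      - θ k ^ 2 * (P k.2.2.1.1 k.2.2.1.2.1 k.2.2.1.2.2.1 k.2.2.1.2.2.2 *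
          visits (fun i => X i ω) k.2.1 k.2.2.1.1 k.2.2.1.2.1 k.2.2.1.2.2.2)}
  have hsub : {ω | ¬ CountsConcentrate P T L fun i => X i ω} ⊆ ⋃ k, E k := by
    intro ω hω
    by_contra hnot
    refine hω fun t ht s a s' h => ?_
    have hn : visits (fun i => X i ω) t s a h < T := (visits_le _ _ _ _ _).trans_lt ht
    have hE : ∀ k, ω ∉ E k := fun k hk => hnot (Set.mem_iUnion.2 ⟨k, hk⟩)
    have h1 := hE (⟨_, hn⟩, ⟨t, ht⟩, (s, a, s', h), true)
    have h2 := hE (⟨_, hn⟩, ⟨t, ht⟩, (s, a, s', h), false)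
    simp only [E, θ, Set.mem_ofPred_eq, not_le, if_true, one_mul, Bool.false_eq_true, if_false,
      neg_one_mul] at h1 h2
    exact abs_le_of_tilts hL h1 h2
  refine (measureReal_mono hsub).trans ((measureReal_iUnion_fintype_le _).trans ?_)
  refine (Finset.sum_le_sum fun k _ =>
    hrun.measureReal_transition_le hM k.2.1.2.le _ _ _ _ (hθ k) (2 * L)).trans (le_of_eq ?_)
  simp only [Finset.sum_const, Finset.card_univ, ι, Fintype.card_prod, Fintype.card_fin,
    Fintype.card_bool, nsmul_eq_mul, Nat.cast_mul, Nat.cast_ofNat]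
  ring

/-- The expected inverse visit counts are logarithmically small. -/
def OccBounded (p : S → ℝ) (P : Fn' S A H) (T : ℕ) (L : ℝ) (X : ℕ → Traj S A H)
    (π : ℕ → PolicyFn S A H) : Prop :=
  ∀ s a h, ∑ t ∈ Finset.range T, (max 1 (visits X t s a h : ℝ))⁻¹ * occ p P (π t) s a h ≤ 8 * L

/-- Off the exceptional events the expected sum is at most twice (realised sum + L), and the
realised sum is at most 3 log(T+1) ≤ 3L: hence 8L. -/
theorem IsRun.measureReal_not_occBounded_le [IsProbabilityMeasure μ] (hM : IsMDP p P)
    (hrun : IsRun μ p P astar T ρ δ η ψ ℱ f g X lam qhat π) {L : ℝ}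
    (hL : Real.log ((T : ℝ) + 1) ≤ L) :
    μ.real {ω | ¬ OccBounded p P T L (fun i => X i ω) fun i => π i ω} ≤
      Fintype.card S * Fintype.card A * H * Real.exp (-L) := by
  classical
  let E : S × A × Fin H → Set Ω := fun k => {ω | L ≤ ∑ t ∈ Finset.range T,
      ((max 1 (visits (fun i => X i ω) t k.1 k.2.1 k.2.2 : ℝ))⁻¹ *
          occ p P (π t ω) k.1 k.2.1 k.2.2 / 2
        - (max 1 (visits (fun i => X i ω) t k.1 k.2.1 k.2.2 : ℝ))⁻¹ *
          (if (X t ω).1 k.2.2.castSucc = k.1 ∧ (X t ω).2 k.2.2 = k.2.1 then 1 else 0))}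
  have hsub : {ω | ¬ OccBounded p P T L (fun i => X i ω) fun i => π i ω} ⊆ ⋃ k, E k := by
    intro ω hω
    by_contra hnot
    refine hω fun s a h => ?_
    have h1 : ω ∉ E (s, a, h) := fun hk => hnot (Set.mem_iUnion.2 ⟨_, hk⟩)
    simp only [E, Set.mem_ofPred_eq, not_le, Finset.sum_sub_distrib, ← Finset.sum_div] at h1
    have h2 := sum_visit_inv_le (fun i => X i ω) T s a h
    have h3 : Real.log ((visits (fun i => X i ω) T s a h : ℝ) + 1) ≤ Real.log ((T : ℝ) + 1) :=
      Real.log_le_log (by positivity) (by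
        have : (visits (fun i => X i ω) T s a h : ℝ) ≤ T :=
          Nat.cast_le.2 (visits_le _ _ _ _ _)
        linarith)
    linarith
  refine (measureReal_mono hsub).trans ((measureReal_iUnion_fintype_le _).trans ?_)
  refine (Finset.sum_le_sum fun k _ =>
    hrun.measureReal_occ_le hM k.1 k.2.1 k.2.2 L).trans (le_of_eq ?_)
  simp only [Finset.sum_const, Finset.card_univ, Fintype.card_prod, Fintype.card_fin,
    nsmul_eq_mul, Nat.cast_mul]
  ring

theorem IsRun.one_sub_le_measureReal [IsProbabilityMeasure μ] (hM : IsMDP p P)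
    (hH : 0 < H) (hT : 0 < T) (hδ : 0 < δ) (hδ4 : δ < 1 / 4)
    (hrun : IsRun μ p P astar T ρ δ η ψ ℱ f g X lam qhat π) {E : Set Ω}
    (hE : ∀ ω, CountsConcentrate P T (logFactor S A H T δ) (fun i => X i ω) →
      OccBounded p P T (logFactor S A H T δ) (fun i => X i ω) (fun i => π i ω) → ω ∈ E) :
    1 - 4 * δ ≤ μ.real E := by
  have hS : Nonempty S := by
    by_contra hne
    rw [not_nonempty_iff] at hne
    simpa using hM.init_sum
  have hA : Nonempty A := ⟨astar⟩
  obtain ⟨hL1, hLT, hexp⟩ := logFactor_facts (S := S) (A := A) hH hT hδ hδ4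
  set L := logFactor S A H T δ with hLdef
  have h1 := hrun.measureReal_not_countsConcentrate_le hM (L := L) (by linarith)
  have h2 := hrun.measureReal_not_occBounded_le hM hLT
  have e1 : (1 : ℝ) ≤ H := by exact_mod_cast hH
  have e2 : (1 : ℝ) ≤ T := by exact_mod_cast hT
  have e3 : (1 : ℝ) ≤ Fintype.card S := by exact_mod_cast Fintype.card_pos
  have e4 : (1 : ℝ) ≤ Fintype.card A := by exact_mod_cast Fintype.card_pos
  -- The tilt level 2L gives e^{-2L} = (δ/(HSAT))², which pays for the factor T²S².
  have h1' : 2 * (T : ℝ) ^ 2 * Fintype.card S ^ 2 * Fintype.card A * H * Real.exp (-(2 * L))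
      ≤ 2 * δ := by
    rw [show -(2 * L) = -L + -L by ring, Real.exp_add, hexp]
    have : 2 * (T : ℝ) ^ 2 * Fintype.card S ^ 2 * Fintype.card A * H *
        (δ / ((H : ℝ) * Fintype.card S * Fintype.card A * T) *
          (δ / ((H : ℝ) * Fintype.card S * Fintype.card A * T))) =
        2 * δ * (δ / (H * Fintype.card A)) := by
      field_simp
    rw [this]
    refine mul_le_of_le_one_right (by linarith) ?_
    rw [div_le_one (by positivity)]
    linarith [one_le_mul_of_one_le_of_one_le e1 e4]
  have h2' : Fintype.card S * Fintype.card A * H * Real.exp (-L) ≤ δ := by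
    rw [hexp]
    have : Fintype.card S * Fintype.card A * H *
        (δ / ((H : ℝ) * Fintype.card S * Fintype.card A * T)) = δ / T := by
      field_simp
    rw [this]
    exact div_le_self hδ.le e2
  -- Covering the whole space and using subadditivity avoids any measurability of `E`.
  have huniv : (Set.univ : Set Ω) ⊆ (E ∪ {ω | ¬ CountsConcentrate P T L fun i => X i ω}) ∪
      {ω | ¬ OccBounded p P T L (fun i => X i ω) fun i => π i ω} := by
    intro ω _
    by_cases hc : CountsConcentrate P T L fun i => X i ω
    · by_cases ho : OccBounded p P T L (fun i => X i ω) fun i => π i ω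
      · exact Or.inl (Or.inl (hE ω hc ho))
      · exact Or.inr ho
    · exact Or.inl (Or.inr hc)
  have h3 := (measureReal_mono (μ := μ) huniv).trans (measureReal_union_le _ _)
  have h4 := measureReal_union_le (μ := μ) E {ω | ¬ CountsConcentrate P T L fun i => X i ω}
  rw [probReal_univ] at h3
  linarith

end Run

/-! ### Kernels in the confidence set -/

/-- Elementary estimate behind the width of the confidence set: `y` is the empirical frequency, `x`
the true probability, `b` the inverse sample size times the logarithmic factor. -/
theorem abs_sub_le_of_radius {x y z b c : ℝ} (hx : 0 ≤ x) (hb : 0 ≤ b)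
    (hc0 : 0 ≤ c) (hc : c ≤ 2 * b)
    (hyx : |y - x| ≤ 3 * (√(x * b) + b)) (hzy : |z - y| ≤ 2 * √(y * c) + 14 / 3 * c) :
    |z - x| ≤ 21 * (√(x * b) + b) := by
  have h1 : √(x * b) ≤ (x + b) / 2 := by
    rw [Real.sqrt_le_left (by positivity)]
    nlinarith [sq_nonneg (x - b)]
  -- This replaces y by x under the root. The final coefficients are 3 + 8 = 11 for √(xb) and 3 + 8
  -- + 28/3 < 21 for b.
  have hy : y ≤ 5 * (x + b) := by
    have := (abs_le.1 hyx).2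
    linarith
  have h2 : √(y * c) ≤ 4 * √(x * b) + 4 * b := by
    rw [Real.sqrt_le_left (by positivity)]
    have h3 := Real.sq_sqrt (mul_nonneg hx hb)
    have h4 := Real.sqrt_nonneg (x * b)
    have h5 : y * c ≤ 5 * (x + b) * (2 * b) :=
      (mul_le_mul_of_nonneg_right hy hc0).trans
        (mul_le_mul_of_nonneg_left hc (by positivity))
    nlinarith [mul_nonneg h4 hb, sq_nonneg b, mul_nonneg hx hb]
  have h6 := abs_sub_le z y x
  have := Real.sqrt_nonneg (x * b)
  linarith

theorem abs_sub_le_of_mem_confSet {P Phat : Fn' S A H} (hP : IsKernel P) {T : ℕ} {δ : ℝ}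
    {X : ℕ → Traj S A H} (hL : 1 ≤ logFactor S A H T δ)
    (hcon : CountsConcentrate P T (logFactor S A H T δ) X) {t : ℕ} (ht : t < T)
    (hmem : Phat ∈ confSet T δ X t) (s : S) (a : A) (s' : S) (h : Fin H) :
    |Phat s a s' h - P s a s' h| ≤
      21 * (√(P s a s' h * (logFactor S A H T δ * (max 1 (visits X t s a h : ℝ))⁻¹))
        + logFactor S A H T δ * (max 1 (visits X t s a h : ℝ))⁻¹) := by
  have hbound := hmem.2 s a s' h
  have hc := hcon t ht s a s' h
  unfold radius at hbound
  set L := logFactor S A H T δ with hLdef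
  set N : ℝ := (visits X t s a h : ℝ) with hN
  set m : ℝ := max 1 N with hm
  set r : ℝ := max 1 (N - 1) with hr
  have hm1 : 1 ≤ m := le_max_left _ _
  have hr1 : 1 ≤ r := le_max_left _ _
  have hN0 : 0 ≤ N := Nat.cast_nonneg _
  -- The radius involves N - 1 instead of N; this costs a factor 2.
  have hmr : m ≤ 2 * r := by
    refine max_le (by linarith) ?_
    have : N - 1 ≤ r := le_max_right _ _
    linarith
  have hP0 := hP.1 s a s' h
  refine abs_sub_le_of_radius (y := empirical X t s a s' h) (c := L / r) hP0
    (by positivity) (by positivity) ?_ ?_ ?_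
  · rw [← div_eq_mul_inv, ← mul_div_assoc, div_le_div_iff₀ (by linarith) (by linarith)]
    nlinarith
  -- For an unvisited pair the empirical frequency is 0, and the error is at most 1 ≤ L.
  · by_cases hv : visits X t s a h = 0
    · have hv' : visits' X t s a s' h = 0 :=
        Nat.le_zero.1 ((visits'_le_visits X t s a s' h).trans hv.le)
      have hP1 : P s a s' h ≤ 1 := by
        rw [← hP.2 s a h]
        exact Finset.single_le_sum (f := fun s' => P s a s' h) (fun _ _ => hP.1 _ _ _ _)
          (Finset.mem_univ s')
      have hm' : m = 1 := by simp [hm, hN, hv]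
      rw [empirical, hv', hm']
      simp only [Nat.cast_zero, zero_div, zero_sub, abs_neg, inv_one, mul_one]
      rw [abs_of_nonneg hP0]
      have := Real.sqrt_nonneg (P s a s' h * L)
      linarith
    · have hNm : N = m := by
        rw [hm, max_eq_right]
        exact Nat.one_le_cast.2 (Nat.one_le_iff_ne_zero.2 hv)
      rw [hNm] at hc
      have hm0 : 0 < m := by linarith
      have he : empirical X t s a s' h - P s a s' h =
          ((visits' X t s a s' h : ℝ) - P s a s' h * m) / m := by
        rw [empirical, sub_div, mul_div_cancel_right₀ _ hm0.ne']
      have hs : √(P s a s' h * (L * m⁻¹)) = √(P s a s' h * m * L) / m := by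
        rw [← Real.sqrt_sq hm0.le, ← Real.sqrt_div (by positivity), Real.sqrt_sq hm0.le]
        congr 1
        field_simp
      rw [he, abs_div, abs_of_pos hm0, hs, div_le_iff₀ hm0]
      refine hc.trans (le_of_eq ?_)
      field_simp
  · refine hbound.trans (le_of_eq ?_)
    rw [mul_div_assoc (empirical X t s a s' h)]
    congr 1
    field_simp

/-! ### The regret bound on the good event -/

theorem abs_bellmanGap_le {P Phat : Fn' S A H} {π : PolicyFn S A H} {f : Fn S A H}
    (hP : IsKernel P) (hPhat : IsKernel Phat) (hπ : IsPolicy π)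
    (hf : ∀ s a h, f s a h ∈ Set.Icc (0 : ℝ) 1) {s : S} {a : A} {h : Fin H} {b : ℝ} (hb : 0 ≤ b)
    (hclose : ∀ s', |Phat s a s' h - P s a s' h| ≤ 21 * (√(P s a s' h * b) + b)) :
    |bellmanGap P Phat π f s a h| ≤
      21 * (√(Fintype.card S * b) * √(valueVar P Phat π f s a h) + Fintype.card S * b * H) := by
  set V := value Phat π f h.succ with hV
  have hV0 : ∀ s, V s ∈ Set.Icc (0 : ℝ) H := fun s => by
    have := value_mem hPhat hπ hf h.succ s
    exact ⟨this.1, this.2.trans (by simp; positivity)⟩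
  set m := ∑ u, P s a u h * V u with hm
  have hm0 : m ∈ Set.Icc (0 : ℝ) H := sum_mul_mem_Icc (hP.1 s a · h) (hP.2 s a h) hV0
  -- Both kernels sum to one, so a constant may be subtracted from V; the mean under P makes the
  -- variance appear.
  have hcenter : bellmanGap P Phat π f s a h =
      ∑ s', (Phat s a s' h - P s a s' h) * (V s' - m) := by
    simp_rw [mul_sub, Finset.sum_sub_distrib, ← Finset.sum_mul, Finset.sum_sub_distrib,
      hP.2, hPhat.2, sub_self, zero_mul, sub_zero]
    rfl
  have hterm : ∀ s', |(Phat s a s' h - P s a s' h) * (V s' - m)| ≤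
      21 * (√b * √(P s a s' h * (V s' - m) ^ 2) + b * H) := by
    intro s'
    have hVm : |V s' - m| ≤ H := by
      have := hV0 s'
      rw [abs_le]
      constructor <;> linarith [this.1, this.2, hm0.1, hm0.2]
    have h1 : √(P s a s' h * b) * |V s' - m| = √b * √(P s a s' h * (V s' - m) ^ 2) := by
      rw [← Real.sqrt_sq_eq_abs, ← Real.sqrt_mul (mul_nonneg (hP.1 _ _ _ _) hb),
        ← Real.sqrt_mul hb]
      congr 1
      ring
    rw [abs_mul]
    calc _ ≤ 21 * (√(P s a s' h * b) + b) * |V s' - m| :=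
          mul_le_mul_of_nonneg_right (hclose s') (abs_nonneg _)
      _ = 21 * (√b * √(P s a s' h * (V s' - m) ^ 2) + b * |V s' - m|) := by rw [← h1]; ring
      _ ≤ _ := by gcongr
  rw [hcenter]
  refine (Finset.abs_sum_le_sum_abs _ _).trans ((Finset.sum_le_sum fun s' _ => hterm s').trans ?_)
  rw [← Finset.mul_sum, Finset.sum_add_distrib]
  have hcs := Real.sum_sqrt_mul_sqrt_le (Finset.univ : Finset S) (f := fun _ => b)
    (g := fun s' => P s a s' h * (V s' - m) ^ 2) (fun _ => hb)
    (fun s' => mul_nonneg (hP.1 _ _ _ _) (sq_nonneg _))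
  simp only [Finset.sum_const, Finset.card_univ, nsmul_eq_mul] at hcs ⊢
  have : ∑ s', P s a s' h * (V s' - m) ^ 2 = valueVar P Phat π f s a h := rfl
  rw [this] at hcs
  linarith

/-- Split the root by subadditivity and use 21√(2nGY) ≤ 441nG + Y/2; absorbing Y/2 on the left
yields 924 = 2(441 + 21). -/
theorem le_of_le_sqrt_self {Y G n T : ℝ} (hY : 0 ≤ Y) (hG : 0 ≤ G) (hn : 0 ≤ n) (hT : 0 ≤ T)
    (h : Y ≤ 21 * (√G * √(2 * n * (n * T + Y)) + n * G)) :
    Y ≤ 42 * √(2 * n ^ 2 * T * G) + 924 * (n * G) := by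
  have h1 : √G * √(2 * n * (n * T + Y)) ≤ √(2 * n ^ 2 * T * G) + √(2 * (n * G) * Y) := by
    rw [← Real.sqrt_mul hG]
    rw [show G * (2 * n * (n * T + Y)) = 2 * n ^ 2 * T * G + 2 * (n * G) * Y by ring,
      Real.sqrt_le_left (by positivity), add_sq, Real.sq_sqrt (by positivity),
      Real.sq_sqrt (by positivity)]
    have : 0 ≤ 2 * √(2 * n ^ 2 * T * G) * √(2 * (n * G) * Y) := by positivity
    linarith
  have h2 : 21 * √(2 * (n * G) * Y) ≤ 441 * (n * G) + Y / 2 := by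
    have hnG : 0 ≤ n * G := by positivity
    rw [← le_div_iff₀' (by norm_num), Real.sqrt_le_left (by positivity)]
    nlinarith [sq_nonneg (441 * (n * G) - Y / 2)]
  linarith

theorem pairing_eq_sum_prod (f q : Fn S A H) :
    pairing f q = ∑ w : S × A × Fin H, f w.1 w.2.1 w.2.2 * q w.1 w.2.1 w.2.2 := by
  simp_rw [pairing, Fintype.sum_prod_type]

theorem abs_pairing_le (f q : Fn S A H) (hq : ∀ s a h, 0 ≤ q s a h) :
    |pairing f q| ≤ pairing (fun s a h => |f s a h|) q := by
  rw [pairing_eq_sum_prod, pairing_eq_sum_prod]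
  refine (Finset.abs_sum_le_sum_abs _ _).trans (le_of_eq (Finset.sum_congr rfl fun w _ => ?_))
  rw [abs_mul, abs_of_nonneg (hq _ _ _)]

theorem sum_pairing_bellmanGap_le {p : S → ℝ} {P : Fn' S A H} (hM : IsMDP p P) {T : ℕ} {L : ℝ}
    (hL : 0 ≤ L) {Phat : ℕ → Fn' S A H} {π : ℕ → PolicyFn S A H} {f : ℕ → Fn S A H}
    {x : ℕ → Fn S A H} (hPhat : ∀ t < T, IsKernel (Phat t)) (hπ : ∀ t < T, IsPolicy (π t))
    (hf : ∀ t < T, ∀ s a h, f t s a h ∈ Set.Icc (0 : ℝ) 1) (hx : ∀ t s a h, 0 ≤ x t s a h)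
    (hclose : ∀ t < T, ∀ s a s' h, |Phat t s a s' h - P s a s' h| ≤
      21 * (√(P s a s' h * (L * x t s a h)) + L * x t s a h))
    (hocc : ∀ s a h, ∑ t ∈ Finset.range T, x t s a h * occ p P (π t) s a h ≤ 8 * L) :
    ∑ t ∈ Finset.range T,
        pairing (fun s a h => |bellmanGap P (Phat t) (π t) (f t) s a h|) (occ p P (π t)) ≤
      42 * √(2 * (H : ℝ) ^ 2 * T * (8 * H * Fintype.card S ^ 2 * Fintype.card A * L ^ 2))
        + 924 * (H * (8 * H * Fintype.card S ^ 2 * Fintype.card A * L ^ 2)) := by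
  have hq : ∀ t < T, ∀ s a h, 0 ≤ occ p P (π t) s a h := fun t ht =>
    occ_nonneg hM.init_nonneg hM.kernel (hπ t ht)
  set Y := ∑ t ∈ Finset.range T,
    pairing (fun s a h => |bellmanGap P (Phat t) (π t) (f t) s a h|) (occ p P (π t)) with hYdef
  have hY0 : 0 ≤ Y := Finset.sum_nonneg fun t ht =>
    (abs_nonneg _).trans (abs_pairing_le (bellmanGap P (Phat t) (π t) (f t)) _
      (hq t (Finset.mem_range.1 ht)))
  set Z := ∑ t ∈ Finset.range T,
    pairing (valueVar P (Phat t) (π t) (f t)) (occ p P (π t)) with hZdef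
  have hZ : Z ≤ 2 * H * (H * T + Y) := by
    refine (Finset.sum_le_sum fun t ht => pairing_valueVar_le hM.init_nonneg hM.init_sum hM.kernel
      (hPhat t (Finset.mem_range.1 ht)) (hπ t (Finset.mem_range.1 ht))
      (hf t (Finset.mem_range.1 ht))).trans (le_of_eq ?_)
    rw [← Finset.mul_sum, Finset.sum_add_distrib, ← hYdef]
    simp only [Finset.sum_const, Finset.card_range, nsmul_eq_mul]
    ring
  set K := ∑ t ∈ Finset.range T, pairing (x t) (occ p P (π t)) with hKdef
  have hK : K ≤ 8 * H * Fintype.card S * Fintype.card A * L := by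
    simp_rw [hKdef, pairing_eq_sum_prod]
    rw [Finset.sum_comm]
    refine (Finset.sum_le_sum fun w _ => hocc w.1 w.2.1 w.2.2).trans (le_of_eq ?_)
    simp only [Finset.sum_const, Finset.card_univ, Fintype.card_prod, Fintype.card_fin,
      nsmul_eq_mul, Nat.cast_mul]
    ring
  have hG : Fintype.card S * L * K ≤ 8 * H * Fintype.card S ^ 2 * Fintype.card A * L ^ 2 := by
    refine (mul_le_mul_of_nonneg_left hK (by positivity)).trans (le_of_eq ?_)
    ring
  refine le_of_le_sqrt_self hY0 (by positivity) (by positivity) (by positivity) ?_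
  have hstep : Y ≤ 21 * (√(Fintype.card S * L * K) * √Z + H * (Fintype.card S * L * K)) := by
    let I : Finset (ℕ × S × A × Fin H) := Finset.range T ×ˢ Finset.univ
    let q : ℕ × S × A × Fin H → ℝ := fun k => occ p P (π k.1) k.2.1 k.2.2.1 k.2.2.2
    let y : ℕ × S × A × Fin H → ℝ := fun k => x k.1 k.2.1 k.2.2.1 k.2.2.2
    let v : ℕ × S × A × Fin H → ℝ := fun k =>
      valueVar P (Phat k.1) (π k.1) (f k.1) k.2.1 k.2.2.1 k.2.2.2
    have hKI : K = ∑ k ∈ I, y k * q k := by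
      simp_rw [hKdef, pairing_eq_sum_prod, I, Finset.sum_product]
      rfl
    have hZI : Z = ∑ k ∈ I, v k * q k := by
      simp_rw [hZdef, pairing_eq_sum_prod, I, Finset.sum_product]
      rfl
    have hqI : ∀ k ∈ I, 0 ≤ q k := fun k hk =>
      hq _ (Finset.mem_range.1 (Finset.mem_product.1 hk).1) _ _ _
    have hvI : ∀ k, 0 ≤ v k := fun k => valueVar_nonneg hM.kernel _ _ _ _ _ _
    have hyI : ∀ k, 0 ≤ y k := fun k => hx _ _ _ _
    have hYI : Y ≤ ∑ k ∈ I, 21 * (√(Fintype.card S * L * (y k * q k)) * √(v k * q k)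
        + H * (Fintype.card S * L * (y k * q k))) := by
      simp_rw [hYdef, pairing_eq_sum_prod, I]
      rw [Finset.sum_product]
      refine Finset.sum_le_sum fun t ht => Finset.sum_le_sum fun w _ => ?_
      have ht := Finset.mem_range.1 ht
      have h1 := abs_bellmanGap_le hM.kernel (hPhat t ht) (hπ t ht) (hf t ht)
        (mul_nonneg hL (hx t w.1 w.2.1 w.2.2)) (fun s' => hclose t ht w.1 w.2.1 s' w.2.2)
      have hqw := hq t ht w.1 w.2.1 w.2.2
      refine (mul_le_mul_of_nonneg_right h1 hqw).trans (le_of_eq ?_)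
      -- The weight q is split as √q·√q between the two factors, ready for Cauchy-Schwarz over all
      -- (t, s, a, h).
      have h2 : √(Fintype.card S * L * (y (t, w) * q (t, w))) * √(v (t, w) * q (t, w)) =
          √(Fintype.card S * (L * y (t, w))) * √(v (t, w)) * q (t, w) := by
        rw [← mul_assoc, Real.sqrt_mul' _ hqw, Real.sqrt_mul' _ hqw, mul_mul_mul_comm,
          Real.mul_self_sqrt hqw, mul_assoc (Fintype.card S : ℝ)]
      rw [h2]
      simp only [q, y, v]
      ring
    refine hYI.trans ?_
    rw [← Finset.mul_sum, Finset.sum_add_distrib, ← Finset.mul_sum, ← Finset.mul_sum, ← hKI]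
    refine mul_le_mul_of_nonneg_left (add_le_add_left ?_ _) (by norm_num)
    rw [hKI, hZI, Finset.mul_sum]
    -- Cauchy-Schwarz is applied to functions nonnegative everywhere, while q is known to be
    -- nonnegative only for t < T.
    have habs : ∀ k ∈ I, |q k| = q k := fun k hk => abs_of_nonneg (hqI k hk)
    have hcs := Real.sum_sqrt_mul_sqrt_le I (f := fun k => Fintype.card S * L * (y k * |q k|))
      (g := fun k => v k * |q k|)
      (fun k => mul_nonneg (by positivity) (mul_nonneg (hyI k) (abs_nonneg _)))
      (fun k => mul_nonneg (hvI k) (abs_nonneg _))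
    refine le_trans (le_of_eq ?_) (hcs.trans (le_of_eq ?_))
    · exact Finset.sum_congr rfl fun k hk => by rw [habs k hk]
    · congr 2 <;> exact Finset.sum_congr rfl fun k hk => by rw [habs k hk]
  refine hstep.trans ?_
  gcongr

theorem sqrt_regret_le {n s a T L : ℝ} (hn : 0 ≤ n) (hs : 0 ≤ s) (hL : 1 ≤ L) :
    √(2 * n ^ 2 * T * (8 * n * s ^ 2 * a * L ^ 2)) ≤
      4 * (n ^ (3 / 2 : ℝ) * s * √(a * T)) * L ^ 2 := by
  have h1 : n ^ (3 / 2 : ℝ) = √(n ^ 3) := by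
    rw [Real.sqrt_eq_rpow, ← Real.rpow_natCast, ← Real.rpow_mul hn]
    norm_num
  have h2 : √(2 * n ^ 2 * T * (8 * n * s ^ 2 * a * L ^ 2)) =
      4 * (n ^ (3 / 2 : ℝ) * s * √(a * T)) * L := by
    rw [h1, show 2 * n ^ 2 * T * (8 * n * s ^ 2 * a * L ^ 2) =
      (4 * s * L) ^ 2 * (n ^ 3 * (a * T)) by ring, Real.sqrt_mul (by positivity),
      Real.sqrt_sq (by positivity), Real.sqrt_mul (by positivity)]
    ring
  rw [h2]
  exact mul_le_mul_of_nonneg_left (by nlinarith) (by positivity)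

section Run

variable {Ω : Type*} [mΩ : MeasurableSpace Ω] {μ : Measure Ω} {p : S → ℝ} {P : Fn' S A H}
  {astar : A} {T : ℕ} {ρ δ η : ℝ} {ψ : ℝ → ℝ} {ℱ : Filtration ℕ mΩ} {f g : ℕ → Ω → Fn S A H}
  {X : ℕ → Ω → Traj S A H} {lam : ℕ → Ω → ℝ} {qhat : ℕ → Ω → Fn S A H}
  {π : ℕ → Ω → PolicyFn S A H}

/-- In every episode `qhat` is the occupancy measure of a kernel close to the true one. -/
theorem IsRun.exists_kernel (hM : IsMDP p P)
    (hrun : IsRun μ p P astar T ρ δ η ψ ℱ f g X lam qhat π) (hL : 1 ≤ logFactor S A H T δ)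
    {ω : Ω} (hcon : CountsConcentrate P T (logFactor S A H T δ) fun i => X i ω) {t : ℕ}
    (ht : t < T) :
    ∃ Phat : Fn' S A H, IsKernel Phat ∧ qhat t ω = occ p Phat (π t ω) ∧
      ∀ s a s' h, |Phat s a s' h - P s a s' h| ≤
        21 * (√(P s a s' h * (logFactor S A H T δ *
            (max 1 (visits (fun i => X i ω) t s a h : ℝ))⁻¹))
          + logFactor S A H T δ * (max 1 (visits (fun i => X i ω) t s a h : ℝ))⁻¹) := by
  by_cases hact : Active T ρ (fun i => g i ω) (fun i => X i ω) t
  · obtain ⟨-, qbar, hflow, hq, Phat, hmem, hind⟩ := hrun.qhat_mem t ht ω hact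
    exact ⟨Phat, hmem.1, eq_occ_of_isFlow hflow hq hmem.1 hind (hrun.π_policy t ht ω)
      (hrun.π_induced t ht ω hact), abs_sub_le_of_mem_confSet hM.kernel hL hcon ht hmem⟩
  -- After the stop, P itself serves, with zero error.
  · refine ⟨P, hM.kernel, hrun.qhat_stopped t ht ω hact, fun s a s' h => ?_⟩
    rw [sub_self, abs_zero]
    positivity

end Run

end EpisodicMDP

end

/-! ### The high-probability bound -/

theorem mainTheorem3 :
    ∃ C : ℝ, 0 < C ∧
      ∀ (S A : Type*) [Fintype S] [Fintype A] (H T : ℕ), 0 < H → 0 < T →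
      ∀ (p : S → ℝ) (P : EpisodicMDP.Fn' S A H), EpisodicMDP.IsMDP p P →
      ∀ (astar : A) (ρ δ η : ℝ) (ψ : ℝ → ℝ),
        ρ ∈ Set.Ioo (0 : ℝ) 1 → δ ∈ Set.Ioo (0 : ℝ) 1 → 0 < η →
      ∀ (Ω : Type*) [mΩ : MeasurableSpace Ω] (μ : MeasureTheory.Measure Ω)
        [MeasureTheory.IsProbabilityMeasure μ] (ℱ : MeasureTheory.Filtration ℕ mΩ)
        (f g : ℕ → Ω → EpisodicMDP.Fn S A H) (X : ℕ → Ω → EpisodicMDP.Traj S A H)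
        (lam : ℕ → Ω → ℝ) (qhat : ℕ → Ω → EpisodicMDP.Fn S A H)
        (π : ℕ → Ω → EpisodicMDP.PolicyFn S A H),
        EpisodicMDP.IsRun μ p P astar T ρ δ η ψ ℱ f g X lam qhat π →
        1 - 4 * δ ≤ μ.real {ω |
          |∑ t ∈ Finset.range T,
              EpisodicMDP.pairing (f t ω) (qhat t ω - EpisodicMDP.occ p P (π t ω))|
            ≤ C * (((H : ℝ) ^ (3 / 2 : ℝ) * Fintype.card S * √((Fintype.card A : ℝ) * T)
                  + (H : ℝ) ^ (5 / 2 : ℝ) * (Fintype.card S : ℝ) ^ 2 * Fintype.card A)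
                * Real.log ((H : ℝ) * Fintype.card S * Fintype.card A * T / δ) ^ 2)} := by
  -- The two terms come with coefficients 42·4 = 168 and 924·8 = 7392.
  refine ⟨10000, by norm_num, ?_⟩
  intro S A _ _ H T hH hT p P hM astar ρ δ η ψ _ hδ _ Ω mΩ μ _ ℱ f g X lam qhat π hrun
  open EpisodicMDP in
  -- For δ ≥ 1/4 the claimed probability is at most 0.
  rcases le_or_gt (1 / 4) δ with hδ4 | hδ4
  · exact le_trans (by linarith) measureReal_nonneg
  refine hrun.one_sub_le_measureReal hM hH hT hδ.1 hδ4 fun ω hcon hocc => ?_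
  have hS : Nonempty S := by
    by_contra hne
    rw [not_nonempty_iff] at hne
    simpa using hM.init_sum
  have hA : Nonempty A := ⟨astar⟩
  have hL := (logFactor_facts (S := S) (A := A) hH hT hδ.1 hδ4).1
  have hex := fun t (ht : t < T) => hrun.exists_kernel hM hL hcon ht
  rw [Set.mem_ofPred_eq]
  change _ ≤ _ * (_ * logFactor S A H T δ ^ 2)
  set L := logFactor S A H T δ with hLdef
  choose! Phat hker hqhat hclose using hex
  have hY := sum_pairing_bellmanGap_le hM (by linarith) (f := fun t => f t ω) hker
    (fun t ht => hrun.π_policy t ht ω) (fun t ht => hrun.f_mem t ht ω)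
    (fun t s a h => by positivity) hclose hocc
  have hsum : |∑ t ∈ Finset.range T, pairing (f t ω) (qhat t ω - occ p P (π t ω))| ≤
      ∑ t ∈ Finset.range T,
        pairing (fun s a h => |bellmanGap P (Phat t) (π t ω) (f t ω) s a h|)
          (occ p P (π t ω)) := by
    refine (Finset.abs_sum_le_sum_abs _ _).trans (Finset.sum_le_sum fun t ht => ?_)
    have ht := Finset.mem_range.1 ht
    have hπ := hrun.π_policy t ht ω
    rw [hqhat t ht, pairing_occ_sub p _ hM.kernel (hker t ht) hπ]
    exact abs_pairing_le _ _ (occ_nonneg hM.init_nonneg hM.kernel hπ)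
  have h1 := sqrt_regret_le (n := H) (s := Fintype.card S) (a := Fintype.card A) (T := T)
    (L := L) (by positivity) (by positivity) hL
  -- The argument yields H² in the lower-order term.
  have h2 : (H : ℝ) ^ 2 ≤ (H : ℝ) ^ (5 / 2 : ℝ) := by
    rw [← Real.rpow_natCast]
    exact Real.rpow_le_rpow_of_exponent_le (by exact_mod_cast hH) (by norm_num)
  have h3 : (H : ℝ) * (8 * H * Fintype.card S ^ 2 * Fintype.card A * L ^ 2) ≤
      8 * ((H : ℝ) ^ (5 / 2 : ℝ) * (Fintype.card S : ℝ) ^ 2 * Fintype.card A) * L ^ 2 := by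
    calc _ = 8 * ((H : ℝ) ^ 2 * (Fintype.card S : ℝ) ^ 2 * Fintype.card A) * L ^ 2 := by ring
      _ ≤ _ := by gcongr
  have h4 : 0 ≤ (H : ℝ) ^ (3 / 2 : ℝ) * Fintype.card S * √((Fintype.card A : ℝ) * T) * L ^ 2 := by
    positivity
  have h5 : 0 ≤ (H : ℝ) ^ (5 / 2 : ℝ) * (Fintype.card S : ℝ) ^ 2 * Fintype.card A * L ^ 2 := by
    positivity
  linarith
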